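/- Let $\mathbb K$ be $\mathbb R$ or $\mathbb C$ and let $M\ge 1$. A matrix in $\mathrm{Mat}_M(\mathbb K)$ is called Hessenberg if it has the form $\sum_{i=1}^{M-1}E_{i,i+1}+\sum_{1\le j\le i\le M}a_{i,j}E_{i,j}$. For a multi-time $\mathbf t=(t_1,t_2,\dots)$ the full Kostant–Toda (f-KT) hierarchy is the system $$\frac{\partial L}{\partial t_k}=[(L^k)_{\ge 0},L],\qquad k=1,2,\dots,$$ for a Hessenberg matrix $L=L(\mathbf t)$, where $(\cdot)_{\ge0}$ denotes the weakly upper triangular part. For an initial matrix $L^0$ put $\Theta_{L^0}(\mathbf t)=\sum_{n\ge1}t_n(L^0)^n$, let $\Delta_N(\mathbf t)$ be the $N$-th leading principal minor of $\exp(\Theta_{L^0}(\mathbf t))$ for $1\le N\le M$, and $\Delta_0=1$. Let $$p_m(x_1,x_2,\dots)=\sum_{i_1+2i_2+\cdots+mi_m=m}\frac{x_1^{i_1}\cdots x_m^{i_m}}{i_1!\cdots i_m!},$$ let $\tilde D=(D_1,\tfrac12D_2,\tfrac13D_3,\dots)$, where $D_n=\frac{\partial}{\partial t_n}-\frac{\partial}{\partial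 t'_n}$ acts on functions of $(\mathbf t,\mathbf t')$, and let $p_m(\tilde D)f\circ g(\mathbf t)$ be the value at $\mathbf t'=\mathbf t$ of $p_m(\tilde D)$ applied to $f(\mathbf t)g(\mathbf t')$. The entries $a_{i,j}(\mathbf t)$ of the solution of the f-KT hierarchy satisfy $$a_{i,j}(\mathbf t)=\frac{p_{i-j+1}(\tilde D)\,\Delta_j\circ\Delta_{i-1}(\mathbf t)}{\Delta_j(\mathbf t)\,\Delta_{i-1}(\mathbf t)}\qquad(1\le j\le i\le M),\tag{$*$}$$ with $\Delta_N(\mathbf t)\ne0$ for all $0\le N\le M$, in each of the following two senses. 1. Let $K\subseteq\{1,2,\dots\}$ be any set of flows (all of them, or for instance $\{1,\dots,M-1\}$), and let $U$ be a set of finitely supported multi-times with $t_k=0$ for $k\notin K$, such that $U$ is open in every coordinate subspace spanned by finitely many of the times $t_k$, $k\in K$ (for $\mathbf t\in U$ and finite $S\subseteq K$, every sufficiently small change of the $t_k$, $k\in S$, stays in $U$), and such that every point of $U$ can be joined to $\mathbf 0$ by a continuous path in $U$ that involves only finitely many of the times. If $L:U\to\mathrm{Mat}_M(\mathbb K)$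 is Hessenberg at every point of $U$ and satisfies $\partial L/\partial t_k=[(L^k)_{\ge0},L]$ on $U$ for all $k\in K$, then $(*)$ holds at every $\mathbf t\in U$, where $L^0=L(\mathbf 0)$. 2. Let $L^0$ be Hessenberg and let $\mathbf t$ be any multi-time for which the series $\Theta_{L^0}(\mathbf t)$ converges absolutely. If $\exp(\Theta_{L^0}(\mathbf t))=ub$ with $u$ lower triangular with ones on the diagonal and $b$ invertible upper triangular, then $(*)$ holds for the entries of $L(\mathbf t)=u^{-1}L^0u$. -/

import Mathlib

open scoped Nat

namespace FullKostantToda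

/-- Multi-times `𝐭 = (t₁, t₂, …)`, indexed by the positive integers. -/
abbrev Times (𝕜 : Type*) : Type _ := ℕ+ → 𝕜

/-- The coordinate direction of the time `t_n`. -/
def timeDir (𝕜 : Type*) [RCLike 𝕜] (n : ℕ+) : Times 𝕜 := Pi.single n 1

section Matrices

variable {𝕜 : Type*} [RCLike 𝕜] {M : ℕ}

/-- Hessenberg form: ones on the first superdiagonal, zeros above it, and arbitrary entries
`a_{i,j}` for `j ≤ i`. -/
def IsHessenberg (A : Matrix (Fin M) (Fin M) 𝕜) : Prop :=
  (∀ i j : Fin M, (j : ℕ) = (i : ℕ) + 1 → A i j = 1) ∧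
    ∀ i j : Fin M, (i : ℕ) + 1 < (j : ℕ) → A i j = 0

/-- `(A)_{≥ 0}`, the weakly upper triangular part of `A`. -/
def upperPart (A : Matrix (Fin M) (Fin M) 𝕜) : Matrix (Fin M) (Fin M) 𝕜 :=
  Matrix.of fun i j => if i ≤ j then A i j else 0

/-- `𝒩⁻`: lower triangular matrices with ones on the diagonal. -/
def IsLowerUnipotent (A : Matrix (Fin M) (Fin M) 𝕜) : Prop :=
  (∀ i, A i i = 1) ∧ ∀ i j : Fin M, i < j → A i j = 0

/-- `ℬ⁺`: invertible upper triangular matrices. -/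
def IsUpperInvertible (A : Matrix (Fin M) (Fin M) 𝕜) : Prop :=
  IsUnit A ∧ ∀ i j : Fin M, j < i → A i j = 0

/-- The `N`-th leading principal minor (the determinant of the upper left `N × N` corner);
it is `1` for `N = 0`. -/
def leadingMinor (A : Matrix (Fin M) (Fin M) 𝕜) (N : ℕ) : 𝕜 :=
  (A.toSquareBlockProp fun k : Fin M => (k : ℕ) < N).det

/-- `Θ_A(𝐭) = ∑_{n ≥ 1} t_n A^n`. -/
noncomputable def theta (A : Matrix (Fin M) (Fin M) 𝕜) (t : Times 𝕜) :
    Matrix (Fin M) (Fin M) 𝕜 :=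
  ∑' n : ℕ+, t n • A ^ (n : ℕ)

/-- The `τ`-function `Δ_N(𝐭)`, the `N`-th leading principal minor of `exp(Θ_{L⁰}(𝐭))`. -/
noncomputable def tau (L₀ : Matrix (Fin M) (Fin M) 𝕜) (N : ℕ) (t : Times 𝕜) : 𝕜 :=
  leadingMinor (NormedSpace.exp (theta L₀ t)) N

end Matrices

section Hirota

variable {𝕜 : Type*} [RCLike 𝕜]

/-- The exponents `(i₁, …, i_m)` with `i₁ + 2 i₂ + ⋯ + m i_m = m`
(the entry with index `k : Fin m` is `i_{k+1}`). -/
def schurExponents (m : ℕ) : Finset (Fin m → ℕ) :=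
  (Fintype.piFinset fun _ : Fin m => Finset.range (m + 1)).filter
    fun e => ∑ k : Fin m, ((k : ℕ) + 1) * e k = m

/-- The elementary Schur polynomial
`p_m(x₁, x₂, …) = ∑_{i₁ + 2 i₂ + ⋯ + m i_m = m} x₁^{i₁} ⋯ x_m^{i_m} / (i₁! ⋯ i_m!)`,
with operators `X n` substituted for the variables `x_n` and the resulting operator applied
to `F`. -/
noncomputable def elemSchurApply {E : Type*} [AddCommGroup E] [Module 𝕜 E] (m : ℕ)
    (X : ℕ+ → E → E) (F : E) : E :=
  ∑ e ∈ schurExponents m,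
    (∏ k : Fin m, ((e k)! : 𝕜)⁻¹) •
      (List.ofFn fun k : Fin m => (X (k : ℕ).succPNat)^[e k]).foldr (fun T G => T G) F

/-- `∂/∂t_n - ∂/∂t'_n` on functions of two multi-times `(𝐭, 𝐭')`. -/
noncomputable def hirotaD (n : ℕ+) (F : Times 𝕜 × Times 𝕜 → 𝕜) : Times 𝕜 × Times 𝕜 → 𝕜 :=
  fun x => lineDeriv 𝕜 F x (timeDir 𝕜 n, 0) - lineDeriv 𝕜 F x (0, timeDir 𝕜 n)

/-- The `n`-th component `(1/n) D_n` of `D̃`. -/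
noncomputable def hirotaDTilde (n : ℕ+) (F : Times 𝕜 × Times 𝕜 → 𝕜) :
    Times 𝕜 × Times 𝕜 → 𝕜 :=
  (((n : ℕ) : 𝕜)⁻¹) • hirotaD n F

/-- The Hirota bilinear expression `p_m(D̃) f ∘ g` at `𝐭`: apply `p_m(D̃)` to
`f(𝐭) g(𝐭')` and then put `𝐭' = 𝐭`. -/
noncomputable def schurHirota (m : ℕ) (f g : Times 𝕜 → 𝕜) (t : Times 𝕜) : 𝕜 :=
  elemSchurApply (𝕜 := 𝕜) m hirotaDTilde (fun x : Times 𝕜 × Times 𝕜 => f x.1 * g x.2) (t, t)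

end Hirota

section Hierarchy

variable {𝕜 : Type*} [RCLike 𝕜]

/-- A domain in the space of finitely supported multi-times in which only the times `t_k`,
`k ∈ K`, are switched on: it is open in all finite-dimensional coordinate subspaces, and each of
its points can be joined to `0` by a path in it that involves finitely many times.
(On a finite-dimensional coordinate subspace the product topology is the usual one.) -/
structure IsTimeDomain (K : Set ℕ+) (U : Set (Times 𝕜)) : Prop where
  finitely_open : ∀ t ∈ U, ∀ S : Finset ℕ+, (S : Set ℕ+) ⊆ K →
    ∃ ε : ℝ, 0 < ε ∧ ∀ t' : Times 𝕜,
      (∀ n ∈ S, ‖t' n - t n‖ < ε) → (∀ n, n ∉ S → t' n = t n) → t' ∈ U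
  joined : ∀ t ∈ U, ∃ S : Finset ℕ+, (S : Set ℕ+) ⊆ K ∧
    JoinedIn {t' : Times 𝕜 | t' ∈ U ∧ ∀ n, n ∉ S → t' n = 0} 0 t

/-- `L` solves, on the set of times `U`, the flows `k ∈ K` of the full Kostant-Toda hierarchy
`∂L/∂t_k = [(L^k)_{≥ 0}, L]` with Hessenberg Lax matrix. -/
structure IsSolution {M : ℕ} (K : Set ℕ+) (U : Set (Times 𝕜))
    (L : Times 𝕜 → Matrix (Fin M) (Fin M) 𝕜) : Prop where
  hessenberg : ∀ t ∈ U, IsHessenberg (L t)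
  flow : ∀ k ∈ K, ∀ t ∈ U, ∀ i j : Fin M,
    HasLineDerivAt 𝕜 (fun s => L s i j)
      ((upperPart (L t ^ (k : ℕ)) * L t - L t * upperPart (L t ^ (k : ℕ))) i j)
      t (timeDir 𝕜 k)

/-- `A` has the lower triangular entries (row `i + 1` and column `j + 1` in one-based numbering)
`a_{i+1,j+1} = p_{i-j+1}(D̃) Δ_{j+1} ∘ Δ_i / (Δ_{j+1} Δ_i)` at the multi-time `t`, with nowhere
vanishing denominators; the `Δ_N` are the `τ`-functions with initial matrix `L₀`. -/
def HasTauEntries {M : ℕ} (L₀ : Matrix (Fin M) (Fin M) 𝕜) (t : Times 𝕜)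
    (A : Matrix (Fin M) (Fin M) 𝕜) : Prop :=
  (∀ N : ℕ, N ≤ M → tau L₀ N t ≠ 0) ∧
    ∀ i j : Fin M, j ≤ i →
      A i j = schurHirota ((i : ℕ) - (j : ℕ) + 1) (tau L₀ ((j : ℕ) + 1)) (tau L₀ (i : ℕ)) t /
        (tau L₀ ((j : ℕ) + 1) t * tau L₀ (i : ℕ) t)

end Hierarchy

end FullKostantToda

/-! Write `A` for the initial matrix and `z` for a formal variable. Since `exp (∑ zⁿ Aⁿ / n) = (1 -
zA)⁻¹`, the generating series `∑ zᵐ p_m(D̃)` multiplies `exp Θ(𝐭)` on the left by `(1 - zA)⁻¹` and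
`exp Θ(𝐭')` by `1 - zA`. So `p_m(D̃) Δ_N ∘ Δ_N'` is the coefficient of `zᵐ` in a product of two
leading minors (`coeff_vertexShift`, `schurHirota_tau`). This is proved formally: line derivatives
are replaced by derivations of a polynomial ring, and the recursion `m p_m = ∑ k x_k p_{m-k}` is
matched with the Euler operator `z d/dz`.

If `exp Θ = u b` and `L = u⁻¹ A u`, the shifted exponentials are `u (1 - zL)⁻¹ b` and `u (1 - zL)
b`. In leading minors `u` disappears and `b` contributes exactly the `τ`-functions, which are
therefore nonzero. What is left is an identity for a Hessenberg matrix,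
`coeff_minor_resolvent_mul_minor_oneSubX`: after the rows from the `i`-th on are set to zero,
Jacobi's identity gives a polynomial of too low degree, and undoing this change contributes one
entry of the matrix.

A solution of the hierarchy is reduced to this case by producing the factorization. Along one flow,
let `b` solve `b' = βb` with `β` the upper part of the Lax power. Uniqueness for linear equations
keeps `b` upper triangular and `exp(…) b⁻¹` lower unipotent (`eventually_gaugeRel`). The relation
`GaugeRel` is symmetric and additive in the exponent, so connectedness carries it along segments,
boxes and finally paths from `0`. -/

namespace FullKostantToda

/-! ### Leading principal minors and Jacobi's identity -/

section Minors

variable {R : Type*} [CommRing R] {M : ℕ}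

/-- The leading principal minor over an arbitrary commutative ring. -/
def minor (A : Matrix (Fin M) (Fin M) R) (N : ℕ) : R :=
  (A.toSquareBlockProp fun k : Fin M => (k : ℕ) < N).det

/-- For rows `p < N` of a lower triangular factor, summation indices `r ≥ N` drop out, so the corner
of the product is the product of the corners. -/
lemma minor_mul_left {A B : Matrix (Fin M) (Fin M) R} (hA : ∀ i j : Fin M, i < j → A i j = 0)
    (N : ℕ) : minor (A * B) N = minor A N * minor B N := by
  rw [minor, minor, minor, ← Matrix.det_mul]
  congr 1
  ext ⟨p, hp⟩ ⟨q, hq⟩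
  simp only [Matrix.toSquareBlockProp_def, Matrix.of_apply, Matrix.mul_apply]
  have h0 : ∀ r : Fin M, ¬ (r : ℕ) < N → A p r * B r q = 0 := fun r h => by
    rw [hA p r (by rw [Fin.lt_def]; omega), zero_mul]
  rw [← Finset.sum_filter_of_ne (p := fun k : Fin M => (k : ℕ) < N)
    fun r _ hr => by_contra fun h => hr (h0 r h)]
  exact (Finset.sum_subtype (p := fun k : Fin M => (k : ℕ) < N) _ (by simp)
    fun r => A p r * B r q)

lemma minor_transpose (A : Matrix (Fin M) (Fin M) R) (N : ℕ) : minor A.transpose N = minor A N := by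
  rw [minor, minor, ← Matrix.det_transpose]
  rfl

lemma minor_mul_right {A B : Matrix (Fin M) (Fin M) R} (hB : ∀ i j : Fin M, j < i → B i j = 0)
    (N : ℕ) : minor (A * B) N = minor A N * minor B N := by
  rw [← minor_transpose, Matrix.transpose_mul,
    minor_mul_left (fun i j hij => by simpa using hB j i hij), minor_transpose, minor_transpose,
    mul_comm]

lemma det_eq_minor_mul_of_upper {A : Matrix (Fin M) (Fin M) R} {N : ℕ}
    (hA : ∀ i j : Fin M, N ≤ (i : ℕ) → (j : ℕ) < N → A i j = 0) :
    A.det = minor A N * (A.toSquareBlockProp fun k : Fin M => ¬ (k : ℕ) < N).det :=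
  A.twoBlockTriangular_det (fun k : Fin M => (k : ℕ) < N)
    fun i hi j hj => hA i j (not_lt.1 hi) hj

lemma det_eq_minor_mul_of_lower {A : Matrix (Fin M) (Fin M) R} {N : ℕ}
    (hA : ∀ i j : Fin M, (i : ℕ) < N → N ≤ (j : ℕ) → A i j = 0) :
    A.det = minor A N * (A.toSquareBlockProp fun k : Fin M => ¬ (k : ℕ) < N).det :=
  A.twoBlockTriangular_det' (fun k : Fin M => (k : ℕ) < N)
    fun i hi j hj => hA i j hi (not_lt.1 hj)

lemma minor_eq_one_of_lower {A : Matrix (Fin M) (Fin M) R} (h1 : ∀ i, A i i = 1)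
    (hA : ∀ i j : Fin M, i < j → A i j = 0) (N : ℕ) : minor A N = 1 := by
  rw [minor, Matrix.det_of_isLowerTriangular]
  · exact Finset.prod_eq_one fun i _ => h1 i
  · intro i j hij
    exact hA i j hij

lemma minor_of_lower_mul_mul_upper {u X b : Matrix (Fin M) (Fin M) R} (h1 : ∀ i, u i i = 1)
    (hu : ∀ i j : Fin M, i < j → u i j = 0) (hb : ∀ i j : Fin M, j < i → b i j = 0) (N : ℕ) :
    minor (u * X * b) N = minor X N * minor b N := by
  rw [minor_mul_right hb, minor_mul_left hu, minor_eq_one_of_lower h1 hu, one_mul]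

lemma isUnit_minor_of_upper {b : Matrix (Fin M) (Fin M) R} (hb : IsUnit b)
    (hb' : ∀ i j : Fin M, j < i → b i j = 0) (N : ℕ) : IsUnit (minor b N) := by
  have h := det_eq_minor_mul_of_upper (A := b) (N := N)
    fun i j hi hj => hb' i j (Fin.lt_def.2 (by omega))
  exact isUnit_of_mul_isUnit_left (h ▸ (Matrix.isUnit_iff_isUnit_det b).1 hb)

/-- Jacobi's complementary minor identity for leading principal minors. -/
lemma det_mul_minor_of_mul_eq_one {A B : Matrix (Fin M) (Fin M) R} (h : A * B = 1) (N : ℕ) :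
    A.det * minor B N = (A.toSquareBlockProp fun k : Fin M => ¬ (k : ℕ) < N).det := by
  -- `Q` has the first `N` columns of `B` and the remaining columns of the identity. Thus `A * Q`
  -- has identity columns first and columns of `A` after, and both determinants collapse to one
  -- block.
  let Q : Matrix (Fin M) (Fin M) R :=
    Matrix.of fun p q : Fin M => if (q : ℕ) < N then B p q else (1 : Matrix (Fin M) (Fin M) R) p q
  have hAQ : A * Q = Matrix.of fun p q : Fin M => if (q : ℕ) < N then (1 : Matrix (Fin M) (Fin M) R) p q
      else A p q := by
    ext p q
    by_cases hq : (q : ℕ) < N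
    · simp only [Matrix.of_apply, hq, if_true, ← h, Matrix.mul_apply, Q]
    · simp [Matrix.mul_apply, Q, hq, Matrix.one_apply]
  have hQ : Q.det = minor B N := by
    rw [det_eq_minor_mul_of_lower (N := N)]
    · have h1 : minor Q N = minor B N := by
        unfold minor
        congr 1
        ext ⟨p, hp⟩ ⟨q, hq⟩
        simp [Matrix.toSquareBlockProp_def, Q, hq]
      have h2 : Q.toSquareBlockProp (fun k : Fin M => ¬ (k : ℕ) < N) = 1 := by
        ext ⟨p, hp⟩ ⟨q, hq⟩
        simp [Matrix.toSquareBlockProp_def, Q, hq, Matrix.one_apply]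
      rw [h1, h2, Matrix.det_one, mul_one]
    · intro i j hi hj
      have : i ≠ j := by rintro rfl; omega
      simp [Q, not_lt.2 hj, this]
  rw [← hQ, ← Matrix.det_mul, hAQ, det_eq_minor_mul_of_upper (N := N)]
  · have h1 : minor (Matrix.of fun p q : Fin M => if (q : ℕ) < N then (1 : Matrix (Fin M) (Fin M) R) p q
      else A p q) N = 1 := by
      refine (congrArg Matrix.det ?_).trans Matrix.det_one
      ext ⟨p, hp⟩ ⟨q, hq⟩
      simp [Matrix.toSquareBlockProp_def, hq, Matrix.one_apply]
    rw [h1, one_mul]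
    congr 1
    ext ⟨p, hp⟩ ⟨q, hq⟩
    simp [Matrix.toSquareBlockProp_def, hq]
  · intro i j hi hj
    have : i ≠ j := by rintro rfl; omega
    simp [hj, this]

/-- Each permutation term takes exactly one entry from every row; the transpose in the proof makes
its product run over rows. -/
lemma natDegree_det_le {n : Type*} [Fintype n] [DecidableEq n] (A : Matrix n n (Polynomial R))
    (d : n → ℕ) (h : ∀ p q, (A p q).natDegree ≤ d p) : A.det.natDegree ≤ ∑ p, d p := by
  rw [← Matrix.det_transpose, Matrix.det_apply]
  refine Polynomial.natDegree_sum_le_of_forall_le _ _ fun σ _ => ?_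
  refine (Polynomial.natDegree_smul_le _ _).trans ?_
  refine (Polynomial.natDegree_prod_le _ _).trans (Finset.sum_le_sum fun p _ => h p _)

end Minors

/-! ### The coefficient identity for Hessenberg matrices -/

section Resolvent

open PowerSeries

variable {R : Type*} [CommRing R] {M : ℕ}

/-- The resolvent `(1 - zA)⁻¹ = ∑ zⁿ Aⁿ` as a matrix of formal power series. -/
noncomputable def resolvent (A : Matrix (Fin M) (Fin M) R) : Matrix (Fin M) (Fin M) R⟦X⟧ :=
  Matrix.of fun p q => PowerSeries.mk fun n => (A ^ n) p q

/-- The matrix `1 - zA` of formal power series. -/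
noncomputable def oneSubX (A : Matrix (Fin M) (Fin M) R) : Matrix (Fin M) (Fin M) R⟦X⟧ :=
  1 - (X : R⟦X⟧) • A.map (C (R := R))

lemma coeff_resolvent (A : Matrix (Fin M) (Fin M) R) (p q : Fin M) (n : ℕ) :
    coeff n (resolvent A p q) = (A ^ n) p q := by
  simp [resolvent]

lemma oneSubX_apply (A : Matrix (Fin M) (Fin M) R) (p q : Fin M) :
    oneSubX A p q = (1 : Matrix (Fin M) (Fin M) R⟦X⟧) p q - X * C (A p q) := by
  simp [oneSubX]

lemma oneSubX_mul_resolvent (A : Matrix (Fin M) (Fin M) R) : oneSubX A * resolvent A = 1 := by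
  ext p q n
  rw [oneSubX, sub_mul, one_mul, Matrix.smul_mul, Matrix.sub_apply, Matrix.smul_apply, map_sub,
    coeff_resolvent, smul_eq_mul]
  cases n with
  | zero =>
    simp only [Matrix.one_apply, pow_zero]
    split_ifs <;> simp
  | succ n =>
    rw [coeff_succ_X_mul, Matrix.mul_apply, map_sum, pow_succ', Matrix.mul_apply]
    simp only [Matrix.map_apply, coeff_C_mul, coeff_resolvent, sub_self]
    rw [Matrix.one_apply]
    split_ifs <;> simp [coeff_one]

/-- `A` with the rows from the `i`-th on replaced by zero. -/
def zeroRowsFrom (A : Matrix (Fin M) (Fin M) R) (i : ℕ) : Matrix (Fin M) (Fin M) R :=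
  Matrix.of fun p q => if (p : ℕ) < i then A p q else 0

/-- Without the rows from `i` on, `1 - zA` is block upper triangular with an identity block in the
lower corner. Turning the minor into a full determinant is what makes Jacobi's identity applicable.
-/
lemma minor_oneSubX_eq_det (A : Matrix (Fin M) (Fin M) R) (i : ℕ) :
    minor (oneSubX A) i = (oneSubX (zeroRowsFrom A i)).det := by
  rw [det_eq_minor_mul_of_upper (N := i)]
  · have h1 : minor (oneSubX (zeroRowsFrom A i)) i = minor (oneSubX A) i := by
      unfold minor
      congr 1
      ext1 ⟨p, hp⟩ ⟨q, hq⟩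
      simp [Matrix.toSquareBlockProp_def, oneSubX_apply, zeroRowsFrom, hp]
    have h2 : (oneSubX (zeroRowsFrom A i)).toSquareBlockProp (fun k : Fin M => ¬ (k : ℕ) < i)
        = 1 := by
      ext1 ⟨p, hp⟩ ⟨q, hq⟩
      simp [Matrix.toSquareBlockProp_def, oneSubX_apply, zeroRowsFrom, hp, Matrix.one_apply]
    rw [h1, h2, Matrix.det_one, mul_one]
  · intro p q hp hq
    have : p ≠ q := by rintro rfl; omega
    simp [oneSubX_apply, zeroRowsFrom, not_lt.2 hp, this]

/-- Only the rows `p` with `N ≤ p < i` involve `z`, each with degree at most one. Polynomials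
replace power series here to have a degree. -/
lemma coeff_det_oneSubX_zeroRowsFrom (A : Matrix (Fin M) (Fin M) R) (i N n : ℕ)
    (hn : i - N < n) :
    coeff n ((oneSubX (zeroRowsFrom A i)).toSquareBlockProp
      fun k : Fin M => ¬ (k : ℕ) < N).det = 0 := by
  let P : Matrix {k : Fin M // ¬ (k : ℕ) < N} {k : Fin M // ¬ (k : ℕ) < N} (Polynomial R) :=
    Matrix.of fun p q => (1 : Matrix _ _ (Polynomial R)) p q -
      Polynomial.X * Polynomial.C (zeroRowsFrom A i p q)
  have hP : (oneSubX (zeroRowsFrom A i)).toSquareBlockProp (fun k : Fin M => ¬ (k : ℕ) < N)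
      = (Polynomial.coeToPowerSeries.ringHom (R := R)).mapMatrix P := by
    ext1 p q
    simp only [Matrix.toSquareBlockProp_def, Matrix.of_apply, oneSubX_apply, RingHom.mapMatrix_apply,
      Matrix.map_apply, P, map_sub, map_mul, Polynomial.coeToPowerSeries.ringHom_apply,
      Polynomial.coe_X, Polynomial.coe_C, Matrix.one_apply, Subtype.ext_iff]
    split_ifs <;> simp
  rw [hP, ← RingHom.map_det, Polynomial.coeToPowerSeries.ringHom_apply, Polynomial.coeff_coe]
  refine Polynomial.coeff_eq_zero_of_natDegree_lt (lt_of_le_of_lt ?_ hn)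
  refine (natDegree_det_le P (fun p => if ((p : Fin M) : ℕ) < i then 1 else 0) ?_).trans ?_
  · intro p q
    simp only [P, Matrix.of_apply, zeroRowsFrom, Matrix.one_apply]
    split_ifs <;> (try simp only [map_zero, mul_zero, sub_zero]) <;> compute_degree
  · rw [← Finset.sum_filter, Finset.sum_const, smul_eq_mul, mul_one]
    refine (Finset.card_le_card_of_injOn
      (fun p : {k : Fin M // ¬ (k : ℕ) < N} => ((p : Fin M) : ℕ))
      (t := Finset.Ico N i) ?_ ?_).trans
      (Nat.card_Ico N i).le
    · intro p hp
      have := p.2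
      simp only [Finset.coe_filter, Finset.mem_univ, true_and, Set.mem_ofPred_eq] at hp
      simp only [Finset.coe_Ico, Set.mem_Ico]
      omega
    · intro p _ q _ h
      exact Subtype.ext (Fin.ext h)

variable {A : Matrix (Fin M) (Fin M) R}

/-- Expand the power over walks: a Hessenberg step raises the index by at most one, so the `n` rows
used, starting from `p`, are all below `i`. -/
lemma pow_zeroRowsFrom_apply (h0 : ∀ p q : Fin M, (p : ℕ) + 1 < q → A p q = 0) (i : ℕ)
    (n : ℕ) : ∀ p q : Fin M, n + p ≤ i → (zeroRowsFrom A i ^ n) p q = (A ^ n) p q := by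
  induction n with
  | zero => intros; simp
  | succ n ih =>
    intro p q hp
    rw [pow_succ', pow_succ', Matrix.mul_apply, Matrix.mul_apply]
    refine Finset.sum_congr rfl fun r _ => ?_
    by_cases hr : (p : ℕ) + 1 < r
    · simp [zeroRowsFrom, h0 p r hr]
    · rw [ih r q (by omega)]
      simp [zeroRowsFrom, show (p : ℕ) < i by omega]

/-- With one step more than before, the only walk that uses a row `≥ i` climbs `p, p + 1, …, i`
along the superdiagonal ones and then jumps from `i` to `q`; its weight is `A i q`. -/
lemma pow_sub_pow_zeroRowsFrom_apply (h1 : ∀ p q : Fin M, (q : ℕ) = p + 1 → A p q = 1)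
    (h0 : ∀ p q : Fin M, (p : ℕ) + 1 < q → A p q = 0) (i : Fin M) (n : ℕ) :
    ∀ p q : Fin M, n + p = i → (A ^ (n + 1)) p q = (zeroRowsFrom A i ^ (n + 1)) p q + A i q := by
  induction n with
  | zero =>
    intro p q hp
    obtain rfl : p = i := Fin.ext (by omega)
    simp [zeroRowsFrom]
  | succ n ih =>
    intro p q hp
    have hp1 : (p : ℕ) + 1 < M := by omega
    rw [pow_succ', pow_succ' _ (n + 1), Matrix.mul_apply, Matrix.mul_apply,
      ← Finset.add_sum_erase _ _ (Finset.mem_univ (⟨p + 1, hp1⟩ : Fin M)),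
      ← Finset.add_sum_erase _ _ (Finset.mem_univ (⟨p + 1, hp1⟩ : Fin M))]
    rw [h1 p ⟨p + 1, hp1⟩ rfl, ih ⟨p + 1, hp1⟩ q (by simp only []; omega)]
    have hz : ∀ r, zeroRowsFrom A i p r = A p r := fun r => by
      rw [zeroRowsFrom, Matrix.of_apply, if_pos (by omega)]
    have hs : ∀ r ∈ Finset.univ.erase (⟨p + 1, hp1⟩ : Fin M), A p r * (A ^ (n + 1)) r q =
        zeroRowsFrom A i p r * (zeroRowsFrom A i ^ (n + 1)) r q := by
      intro r hr
      have hr' : (r : ℕ) ≠ p + 1 := fun h => (Finset.mem_erase.1 hr).1 (Fin.ext h)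
      rw [hz]
      by_cases hr2 : (p : ℕ) + 1 < r
      · simp [h0 p r hr2]
      · rw [pow_zeroRowsFrom_apply h0 i (n + 1) r q (by omega)]
    rw [Finset.sum_congr rfl hs, hz, h1 p ⟨p + 1, hp1⟩ rfl]
    ring

/-- First order perturbation of the determinant of a matrix of power series that is congruent to
the identity. -/
lemma exists_det_add_X_pow_smul {n : Type*} [Fintype n] [DecidableEq n] (B Q : Matrix n n R⟦X⟧)
    (hB : B.map (constantCoeff (R := R)) = 1) {m : ℕ} (hm : m ≠ 0) :
    ∃ W : R⟦X⟧, (B + (X : R⟦X⟧) ^ m • Q).det = B.det + X ^ m * W ∧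
      constantCoeff W = (Q.map (constantCoeff (R := R))).trace := by
  have hdet : constantCoeff B.det = 1 := by
    rw [RingHom.map_det, RingHom.mapMatrix_apply, hB, Matrix.det_one]
  have hu : IsUnit B.det := by
    rw [isUnit_iff_constantCoeff, hdet]
    exact isUnit_one
  have hinv : (B⁻¹).map (constantCoeff (R := R)) = 1 := by
    have h := congrArg (fun Y : Matrix n n R⟦X⟧ => Y.map (constantCoeff (R := R)))
      (Matrix.mul_nonsing_inv B hu)
    simpa [Matrix.map_mul, hB, Matrix.map_one _ (map_zero (constantCoeff (R := R))) (map_one _)] using h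
  -- Factoring out the invertible `B` reduces to the expansion of `det (1 + zᵐ Y)`, whose linear
  -- term is the trace.
  have h1 : B + (X : R⟦X⟧) ^ m • Q = B * (1 + (X : R⟦X⟧) ^ m • (B⁻¹ * Q)) := by
    rw [mul_add, mul_one, Matrix.mul_smul, ← mul_assoc, Matrix.mul_nonsing_inv B hu, one_mul]
  obtain ⟨Z, hZ⟩ : ∃ Z, (1 + (X : R⟦X⟧) ^ m • (B⁻¹ * Q)).det =
      1 + (B⁻¹ * Q).trace * X ^ m + Z * (X ^ m) ^ 2 := ⟨_, Matrix.det_one_add_smul _ _⟩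
  refine ⟨B.det * ((B⁻¹ * Q).trace + Z * X ^ m), ?_, ?_⟩
  · rw [h1, Matrix.det_mul, hZ]
    ring
  · have ht : constantCoeff (B⁻¹ * Q).trace = (Q.map (constantCoeff (R := R))).trace := by
      rw [AddMonoidHom.map_trace, Matrix.map_mul, hinv, one_mul]
    rw [map_mul, map_add, hdet, one_mul, ht, map_mul, map_pow]
    simp [hm]

/-- For a Hessenberg matrix the coefficient of `z^{i-j+1}` in the product of leading principal
minors of `(1 - zA)⁻¹` and `1 - zA` is the entry `a_{i,j}`. -/
theorem coeff_minor_resolvent_mul_minor_oneSubX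
    (h1 : ∀ p q : Fin M, (q : ℕ) = p + 1 → A p q = 1)
    (h0 : ∀ p q : Fin M, (p : ℕ) + 1 < q → A p q = 0) {i j : Fin M} (hij : j ≤ i) :
    coeff ((i : ℕ) - j + 1) (minor (resolvent A) (j + 1) * minor (oneSubX A) i) = A i j := by
  have hij' : (j : ℕ) ≤ i := hij
  set m := (i : ℕ) - j + 1 with hm
  let G := (resolvent A).toSquareBlockProp fun k : Fin M => (k : ℕ) < j + 1
  let G' := (resolvent (zeroRowsFrom A i)).toSquareBlockProp fun k : Fin M => (k : ℕ) < j + 1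
  -- The two resolvent corners agree below order `m`; `Q` is their difference divided by `zᵐ`.
  let Q : Matrix {k : Fin M // (k : ℕ) < j + 1} {k : Fin M // (k : ℕ) < j + 1} R⟦X⟧ :=
    Matrix.of fun p q => PowerSeries.mk fun n => coeff (m + n) (G p q - G' p q)
  have hcoeff : ∀ (p q : {k : Fin M // (k : ℕ) < j + 1}) (n : ℕ), n < m →
      coeff n (G p q) = coeff n (G' p q) := by
    intro p q n hn
    have := p.2
    simp only [G, G', Matrix.toSquareBlockProp_def, Matrix.of_apply, coeff_resolvent]
    exact (pow_zeroRowsFrom_apply h0 _ _ _ _ (by omega)).symm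
  have hG : G = G' + (X : R⟦X⟧) ^ m • Q := by
    ext p q n
    rw [Matrix.add_apply, Matrix.smul_apply, map_add, smul_eq_mul, coeff_X_pow_mul']
    split_ifs with hn
    · simp [Q, Nat.add_sub_cancel' hn]
    · rw [hcoeff p q n (by omega), add_zero]
  have hG' : G'.map (constantCoeff (R := R)) = 1 := by
    ext p q
    rw [Matrix.map_apply, ← coeff_zero_eq_constantCoeff_apply]
    simp only [G', Matrix.toSquareBlockProp_def, Matrix.of_apply, coeff_resolvent, pow_zero,
      Matrix.one_apply, Subtype.ext_iff]
  obtain ⟨W, hW, hW0⟩ := exists_det_add_X_pow_smul G' Q hG' (m := m) (by omega)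
  -- A diagonal entry with `p < j` still satisfies `m + p ≤ i`, so zeroing the rows does not change
  -- it; only `p = j` contributes.
  have hQ : (Q.map (constantCoeff (R := R))).trace = A i j := by
    rw [Matrix.trace, Finset.sum_eq_single (⟨j, by simp⟩ : {k : Fin M // (k : ℕ) < j + 1})]
    · rw [Matrix.diag_apply, Matrix.map_apply, ← coeff_zero_eq_constantCoeff_apply]
      simp only [Q, G, G', Matrix.of_apply, coeff_mk, add_zero, map_sub,
        Matrix.toSquareBlockProp_def, coeff_resolvent]
      rw [hm, pow_sub_pow_zeroRowsFrom_apply h1 h0 i _ j j (by omega)]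
      ring
    · intro p _ hp
      have hp' : ((p : Fin M) : ℕ) ≠ j := fun h => hp (Subtype.ext (Fin.ext h))
      have := p.2
      rw [Matrix.diag_apply, Matrix.map_apply, ← coeff_zero_eq_constantCoeff_apply]
      simp only [Q, G, G', Matrix.of_apply, coeff_mk, add_zero, map_sub,
        Matrix.toSquareBlockProp_def, coeff_resolvent]
      rw [pow_zeroRowsFrom_apply h0 i m p p (by omega), sub_self]
    · simp
  have hH0 : constantCoeff (oneSubX (zeroRowsFrom A i)).det = 1 := by
    rw [RingHom.map_det, RingHom.mapMatrix_apply]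
    refine (congrArg Matrix.det ?_).trans Matrix.det_one
    ext p q
    simp only [oneSubX_apply, Matrix.map_apply, Matrix.one_apply]
    split_ifs <;> simp
  have hmin : minor (resolvent A) (j + 1) = G'.det + X ^ m * W := by
    rw [← hW, ← hG]
    rfl
  rw [hmin, minor_oneSubX_eq_det, mul_comm, mul_add, map_add]
  -- For the truncated matrix the product of minors is a complementary determinant of degree at most
  -- `i - (j + 1)` (truncated subtraction), which is below `m`; only the correction `W` survives.
  have hjac := det_mul_minor_of_mul_eq_one (oneSubX_mul_resolvent (zeroRowsFrom A i)) (j + 1)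
  rw [show G'.det = minor (resolvent (zeroRowsFrom A i)) (j + 1) from rfl, hjac,
    coeff_det_oneSubX_zeroRowsFrom _ _ _ _ (by omega), zero_add, mul_left_comm]
  rw [coeff_X_pow_mul', if_pos le_rfl, Nat.sub_self, coeff_zero_eq_constantCoeff_apply,
    map_mul, hH0, one_mul, hW0, hQ]

end Resolvent

/-! ### Elementary Schur polynomials in commuting operators -/

section Schur

variable {𝕜 : Type*} [Field 𝕜] {𝔸 : Type*} [Ring 𝔸] [Algebra 𝕜 𝔸]

/-- The ordered monomial `x₀^{e₀} ⋯ x_{N-1}^{e_{N-1}}`. -/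
def orderedMonomial {N : ℕ} (x : Fin N → 𝔸) (e : Fin N → ℕ) : 𝔸 :=
  (List.ofFn fun k => x k ^ e k).prod

lemma orderedMonomial_succ {N : ℕ} (x : Fin (N + 1) → 𝔸) (e : Fin (N + 1) → ℕ) :
    orderedMonomial x e =
      x 0 ^ e 0 * orderedMonomial (fun k => x k.succ) (fun k => e k.succ) := by
  simp [orderedMonomial, List.ofFn_succ]

lemma orderedMonomial_castSucc {N : ℕ} (x : Fin (N + 1) → 𝔸) (e : Fin (N + 1) → ℕ) :
    orderedMonomial x e =
      orderedMonomial (fun k => x k.castSucc) (fun k => e k.castSucc) *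
        x (Fin.last N) ^ e (Fin.last N) := by
  simp only [orderedMonomial, List.ofFn_succ_last, List.prod_append, List.prod_singleton]

lemma orderedMonomial_add_single {N : ℕ} {x : Fin N → 𝔸} (hx : ∀ a b, Commute (x a) (x b))
    (e : Fin N → ℕ) (k : Fin N) :
    orderedMonomial x (e + Pi.single k 1) = x k * orderedMonomial x e := by
  induction N with
  | zero => exact k.elim0
  | succ N ih =>
    rw [orderedMonomial_succ, orderedMonomial_succ x e]
    refine Fin.cases ?_ (fun k => ?_) k
    · have h : (fun k : Fin N => (e + Pi.single 0 1 : Fin (N + 1) → ℕ) k.succ) = fun k => e k.succ := by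
        ext k
        simp
      rw [h, Pi.add_apply, Pi.single_eq_same, pow_succ', mul_assoc]
    · have h : (fun l : Fin N => (e + Pi.single k.succ 1 : Fin (N + 1) → ℕ) l.succ) =
          (fun l => e l.succ) + Pi.single k 1 := by
        ext l
        simp [Pi.single_apply]
      rw [h, ih (x := fun k => x k.succ) (fun _ _ => hx _ _), ← mul_assoc, ← mul_assoc]
      simp only [Pi.add_apply, Pi.single_apply, (Fin.succ_ne_zero k).symm, if_false, add_zero]
      rw [((hx 0 k.succ).pow_left _).eq]

lemma Commute.orderedMonomial_right {N : ℕ} {x : Fin N → 𝔸} {y : 𝔸}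
    (hx : ∀ a, Commute y (x a)) (e : Fin N → ℕ) : Commute y (orderedMonomial x e) := by
  refine Commute.list_prod_right _ _ fun z hz => ?_
  obtain ⟨k, rfl⟩ := List.mem_ofFn.1 hz
  exact (hx k).pow_right _

/-- Exponents of weight `m` in `N` variables of weights `1, …, N`. -/
def weightedExponents (N m : ℕ) : Finset (Fin N → ℕ) :=
  (Fintype.piFinset fun _ : Fin N => Finset.range (m + 1)).filter
    fun e => ∑ k : Fin N, ((k : ℕ) + 1) * e k = m

lemma mem_weightedExponents {N m : ℕ} {e : Fin N → ℕ} :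
    e ∈ weightedExponents N m ↔ ∑ k : Fin N, ((k : ℕ) + 1) * e k = m := by
  simp only [weightedExponents, Finset.mem_filter, Fintype.mem_piFinset, Finset.mem_range,
    and_iff_right_iff_imp]
  intro h k
  have h1 : ((k : ℕ) + 1) * e k ≤ m :=
    h ▸ Finset.single_le_sum (f := fun k : Fin N => ((k : ℕ) + 1) * e k) (fun _ _ => Nat.zero_le _)
      (Finset.mem_univ k)
  nlinarith [Nat.zero_le ((k : ℕ) * e k)]

variable (𝕜) in
/-- The elementary Schur polynomial of degree `m` in the operators `x₀, …, x_{N-1}`. -/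
def schurOperator (x : ℕ → 𝔸) (N m : ℕ) : 𝔸 :=
  ∑ e ∈ weightedExponents N m,
    (∏ k : Fin N, ((e k)! : 𝕜)⁻¹) • orderedMonomial (fun k : Fin N => x k) e

lemma schurOperator_zero (x : ℕ → 𝔸) : schurOperator 𝕜 x 0 0 = 1 := by
  have h : weightedExponents 0 0 = {0} := by
    ext e
    simp [mem_weightedExponents, Subsingleton.elim e 0]
  simp [schurOperator, h, orderedMonomial]

/-- The additional variable has weight `N + 1 > m` and cannot occur. This lets all degrees in the
recursion share one number of variables. -/
lemma schurOperator_succ_left (x : ℕ → 𝔸) {N m : ℕ} (h : m ≤ N) :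
    schurOperator 𝕜 x (N + 1) m = schurOperator 𝕜 x N m := by
  have hlast : ∀ e ∈ weightedExponents (N + 1) m, e (Fin.last N) = 0 := by
    intro e he
    rw [mem_weightedExponents, Fin.sum_univ_castSucc] at he
    by_contra h0
    have : 1 ≤ e (Fin.last N) := Nat.one_le_iff_ne_zero.2 h0
    have : (N + 1) * 1 ≤ (N + 1) * e (Fin.last N) := Nat.mul_le_mul_left _ this
    simp only [Fin.val_last] at he
    omega
  refine Finset.sum_nbij' (fun e k => e k.castSucc) (fun e => Fin.snoc (α := fun _ => ℕ) e 0)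
    ?_ ?_ ?_ ?_ ?_
  · intro e he
    have h1 := hlast e he
    rw [mem_weightedExponents, Fin.sum_univ_castSucc, h1] at he
    simpa [mem_weightedExponents] using he
  · intro e he
    rw [mem_weightedExponents] at he ⊢
    simpa [Fin.sum_univ_castSucc] using he
  · intro e he
    have h1 := hlast e he
    ext k
    refine Fin.lastCases ?_ (fun k => ?_) k
    · simp [h1]
    · simp
  · intro e _
    ext k
    simp
  · intro e he
    rw [orderedMonomial_castSucc, Fin.prod_univ_castSucc, hlast e he]
    simp

lemma schurOperator_eq (x : ℕ → 𝔸) {N m : ℕ} (h : m ≤ N) :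
    schurOperator 𝕜 x N m = schurOperator 𝕜 x m m := by
  induction N, h using Nat.le_induction with
  | base => rfl
  | succ N hN ih => rw [schurOperator_succ_left x hN, ih]

/-- This is `x_k ∂p_m/∂x_k = x_k p_{m-k-1}`, with variables indexed from zero: cancel `e k` against
the factorial and lower that exponent by one. -/
lemma sum_weightedExponents_smul [CharZero 𝕜] {x : ℕ → 𝔸} (hx : ∀ a b, Commute (x a) (x b))
    {N m : ℕ} (k : Fin N) :
    ∑ e ∈ weightedExponents N m,
      ((e k : 𝕜) * ∏ k : Fin N, ((e k)! : 𝕜)⁻¹) • orderedMonomial (fun k : Fin N => x k) e =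
    if (k : ℕ) < m then x k * schurOperator 𝕜 x N (m - (k + 1)) else 0 := by
  have hsingle : ∀ e : Fin N → ℕ, ∑ l : Fin N, ((l : ℕ) + 1) * (e + Pi.single k 1 : Fin N → ℕ) l =
      (∑ l : Fin N, ((l : ℕ) + 1) * e l) + (k + 1) := by
    intro e
    simp [mul_add, Finset.sum_add_distrib, Pi.single_apply]
  have hfac : ∀ e : Fin N → ℕ, ((e k + 1 : ℕ) : 𝕜) * ∏ l : Fin N, (((e + Pi.single k 1 : Fin N → ℕ) l)! : 𝕜)⁻¹ =
      ∏ l : Fin N, ((e l)! : 𝕜)⁻¹ := by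
    intro e
    rw [← Finset.mul_prod_erase _ _ (Finset.mem_univ k),
      ← Finset.mul_prod_erase _ (fun l => ((e l)! : 𝕜)⁻¹) (Finset.mem_univ k), ← mul_assoc]
    congr 1
    · have : ((e k + 1 : ℕ) : 𝕜) ≠ 0 := Nat.cast_ne_zero.2 (Nat.succ_ne_zero _)
      rw [Pi.add_apply, Pi.single_eq_same, Nat.factorial_succ, Nat.cast_mul, mul_inv, ← mul_assoc,
        mul_inv_cancel₀ this, one_mul]
    · refine Finset.prod_congr rfl fun l hl => ?_
      rw [Pi.add_apply, Pi.single_eq_of_ne (Finset.ne_of_mem_erase hl), add_zero]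
  have hsub : ∀ e : Fin N → ℕ, e k ≠ 0 → e - Pi.single k 1 + Pi.single k 1 = e := by
    intro e he
    ext l
    by_cases hl : l = k
    · subst hl
      simp only [Pi.add_apply, Pi.sub_apply, Pi.single_eq_same]
      omega
    · simp [hl]
  rw [← Finset.sum_filter_of_ne (p := fun e : Fin N → ℕ => e k ≠ 0)
    fun e _ he h0 => he (by simp [h0])]
  split_ifs with hk
  · rw [schurOperator, Finset.mul_sum]
    symm
    refine Finset.sum_nbij' (fun e => e + Pi.single k 1) (fun e => e - Pi.single k 1)
      ?_ ?_ ?_ ?_ ?_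
    · intro e he
      rw [mem_weightedExponents] at he
      rw [Finset.mem_filter, mem_weightedExponents, hsingle, he]
      refine ⟨by omega, by simp⟩
    · intro e he
      rw [Finset.mem_filter, mem_weightedExponents] at he
      have := hsingle (e - Pi.single k 1)
      rw [hsub e he.2, he.1] at this
      rw [mem_weightedExponents]
      omega
    · intro e _
      simp
    · intro e he
      exact hsub e (Finset.mem_filter.1 he).2
    · intro e _
      rw [orderedMonomial_add_single (fun _ _ => hx _ _), mul_smul_comm, ← hfac e]
      simp
  · refine Finset.sum_eq_zero fun e he => ?_
    exfalso
    rw [Finset.mem_filter, mem_weightedExponents] at he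
    have := hsingle (e - Pi.single k 1)
    rw [hsub e he.2, he.1] at this
    omega

/-- The recursion `m p_m = ∑_{k=1}^m k x_k p_{m-k}`. -/
lemma smul_schurOperator [CharZero 𝕜] {x : ℕ → 𝔸} (hx : ∀ a b, Commute (x a) (x b)) (m : ℕ) :
    (m : 𝕜) • schurOperator 𝕜 x m m =
      ∑ k ∈ Finset.range m, ((k + 1 : ℕ) : 𝕜) •
        (x k * schurOperator 𝕜 x (m - (k + 1)) (m - (k + 1))) := by
  -- On every monomial the scalar `m` equals the total weight `∑ (k + 1) e k`.
  have h : (m : 𝕜) • schurOperator 𝕜 x m m = ∑ k : Fin m, ((k + 1 : ℕ) : 𝕜) •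
      ∑ e ∈ weightedExponents m m,
      ((e k : 𝕜) * ∏ k : Fin m, ((e k)! : 𝕜)⁻¹) • orderedMonomial (fun k : Fin m => x k) e := by
    simp only [Finset.smul_sum]
    rw [Finset.sum_comm, schurOperator, Finset.smul_sum]
    refine Finset.sum_congr rfl fun e he => ?_
    rw [mem_weightedExponents] at he
    simp only [smul_smul]
    rw [← Finset.sum_smul]
    congr 1
    simp only [← mul_assoc]
    rw [← Finset.sum_mul]
    congr 1
    exact_mod_cast he.symm
  rw [h, Finset.sum_range]
  refine Finset.sum_congr rfl fun k _ => ?_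
  rw [sum_weightedExponents_smul hx, if_pos k.2, schurOperator_eq x (by omega)]

lemma Commute.schurOperator_right {x : ℕ → 𝔸} {y : 𝔸} (hx : ∀ a, Commute y (x a)) (N m : ℕ) :
    Commute y (schurOperator 𝕜 x N m) :=
  Commute.sum_right _ _ _ fun e _ =>
    (Commute.orderedMonomial_right (fun k : Fin N => hx k) e).smul_right _

end Schur

/-! ### Transporting Schur polynomials between operator families -/

section ElemSchur

variable {𝕜 : Type*} [RCLike 𝕜] {E : Type*} [AddCommGroup E] [Module 𝕜 E]

lemma foldr_pow_apply {N : ℕ} (D : Fin N → Module.End 𝕜 E) (e : Fin N → ℕ) (F : E) :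
    (List.ofFn fun k => (⇑(D k))^[e k]).foldr (fun T G => T G) F = orderedMonomial D e F := by
  induction N with
  | zero => simp [orderedMonomial]
  | succ N ih =>
    rw [List.ofFn_succ, List.foldr_cons, ih (fun k => D k.succ) fun k => e k.succ,
      orderedMonomial_succ, Module.End.mul_apply, Module.End.pow_apply]

lemma elemSchurApply_linear (m : ℕ) (D : ℕ+ → Module.End 𝕜 E) (F : E) :
    elemSchurApply (𝕜 := 𝕜) m (fun n => ⇑(D n)) F =
      schurOperator 𝕜 (fun k => D k.succPNat) m m F := by
  rw [elemSchurApply, schurOperator, LinearMap.sum_apply]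
  refine Finset.sum_congr rfl fun e _ => ?_
  rw [LinearMap.smul_apply, ← foldr_pow_apply]

/-- A relation between two modules that is linear and is respected by the operators is respected
by elementary Schur polynomials in them. -/
lemma elemSchurApply_rel {E' : Type*} [AddCommGroup E'] [Module 𝕜 E'] (r : E → E' → Prop)
    (h0 : r 0 0) (hadd : ∀ a a' b b', r a a' → r b b' → r (a + b) (a' + b'))
    (hsmul : ∀ (c : 𝕜) a a', r a a' → r (c • a) (c • a')) (X : ℕ+ → E → E) (X' : ℕ+ → E' → E')
    (hX : ∀ n a a', r a a' → r (X n a) (X' n a')) (m : ℕ) {F : E} {F' : E'} (hF : r F F') :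
    r (elemSchurApply (𝕜 := 𝕜) m X F) (elemSchurApply (𝕜 := 𝕜) m X' F') := by
  have hit : ∀ (n : ℕ+) (l : ℕ) a a', r a a' → r ((X n)^[l] a) ((X' n)^[l] a') := by
    intro n l
    induction l with
    | zero => exact fun _ _ h => h
    | succ l ih =>
      intro a a' h
      rw [Function.iterate_succ_apply, Function.iterate_succ_apply]
      exact ih _ _ (hX n _ _ h)
  have hfold : ∀ (N : ℕ) (n : Fin N → ℕ+) (e : Fin N → ℕ),
      r ((List.ofFn fun k => (X (n k))^[e k]).foldr (fun T G => T G) F)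
        ((List.ofFn fun k => (X' (n k))^[e k]).foldr (fun T G => T G) F') := by
    intro N
    induction N with
    | zero => intros; simpa using hF
    | succ N ih =>
      intro n e
      rw [List.ofFn_succ, List.foldr_cons, List.ofFn_succ, List.foldr_cons]
      exact hit _ _ _ _ (ih _ _)
  have hsum : ∀ (s : Finset (Fin m → ℕ)) (f : (Fin m → ℕ) → E) (f' : (Fin m → ℕ) → E'),
      (∀ e, r (f e) (f' e)) → r (∑ e ∈ s, f e) (∑ e ∈ s, f' e) := by
    intro s f f' h
    induction s using Finset.induction_on with
    | empty => simpa using h0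
    | insert a s ha ih =>
      rw [Finset.sum_insert ha, Finset.sum_insert ha]
      exact hadd _ _ _ _ (h a) ih
  exact hsum _ _ _ fun e => hsmul _ _ _ (hfold m (fun k => (k : ℕ).succPNat) e)

end ElemSchur

/-! ### Hirota derivations and the vertex shift -/

section Vertex

open PowerSeries

variable {𝕜 : Type*} [Field 𝕜] {M : ℕ}

/-- Polynomials in the entries of two generic `M × M` matrices. -/
abbrev EntryPoly (𝕜 : Type*) [Field 𝕜] (M : ℕ) : Type _ :=
  MvPolynomial ((Fin M × Fin M) ⊕ (Fin M × Fin M)) 𝕜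

variable (𝕜 M) in
/-- The first generic matrix. -/
noncomputable def genericLeft : Matrix (Fin M) (Fin M) (EntryPoly 𝕜 M) :=
  Matrix.of fun p q => MvPolynomial.X (Sum.inl (p, q))

variable (𝕜 M) in
/-- The second generic matrix. -/
noncomputable def genericRight : Matrix (Fin M) (Fin M) (EntryPoly 𝕜 M) :=
  Matrix.of fun p q => MvPolynomial.X (Sum.inr (p, q))

/-- The derivation multiplying the first generic matrix by `B` on the left. -/
noncomputable def leftDerivation (B : Matrix (Fin M) (Fin M) 𝕜) :
    Derivation 𝕜 (EntryPoly 𝕜 M) (EntryPoly 𝕜 M) :=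
  MvPolynomial.mkDerivation 𝕜
    (Sum.elim (fun e => ∑ r, MvPolynomial.C (B e.1 r) * MvPolynomial.X (Sum.inl (r, e.2))) fun _ => 0)

/-- The derivation multiplying the second generic matrix by `B` on the left. -/
noncomputable def rightDerivation (B : Matrix (Fin M) (Fin M) 𝕜) :
    Derivation 𝕜 (EntryPoly 𝕜 M) (EntryPoly 𝕜 M) :=
  MvPolynomial.mkDerivation 𝕜
    (Sum.elim (fun _ => 0) fun e => ∑ r, MvPolynomial.C (B e.1 r) * MvPolynomial.X (Sum.inr (r, e.2)))

/-- The derivation `X ↦ B X`, `Y ↦ - B Y` on the two generic matrices. -/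
noncomputable def hirotaDerivation (B : Matrix (Fin M) (Fin M) 𝕜) :
    Derivation 𝕜 (EntryPoly 𝕜 M) (EntryPoly 𝕜 M) :=
  leftDerivation B - rightDerivation B

lemma hirotaDerivation_X_inl (B : Matrix (Fin M) (Fin M) 𝕜) (e : Fin M × Fin M) :
    hirotaDerivation B (MvPolynomial.X (Sum.inl e)) =
      ∑ r, MvPolynomial.C (B e.1 r) * MvPolynomial.X (Sum.inl (r, e.2)) := by
  simp [hirotaDerivation, leftDerivation, rightDerivation, MvPolynomial.mkDerivation_X]

lemma hirotaDerivation_X_inr (B : Matrix (Fin M) (Fin M) 𝕜) (e : Fin M × Fin M) :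
    hirotaDerivation B (MvPolynomial.X (Sum.inr e)) =
      -∑ r, MvPolynomial.C (B e.1 r) * MvPolynomial.X (Sum.inr (r, e.2)) := by
  simp [hirotaDerivation, leftDerivation, rightDerivation, MvPolynomial.mkDerivation_X]

lemma derivation_C_mul (d : Derivation 𝕜 (EntryPoly 𝕜 M) (EntryPoly 𝕜 M)) (c : 𝕜)
    (f : EntryPoly 𝕜 M) : d (MvPolynomial.C c * f) = MvPolynomial.C c * d f := by
  rw [← MvPolynomial.smul_eq_C_mul, Derivation.map_smul, MvPolynomial.smul_eq_C_mul]

/-- The order becomes `B' * B` because the outer derivation acts only on the variables left by the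
inner one. The two signs on the second generic matrix cancel. -/
lemma hirotaDerivation_hirotaDerivation_X (B B' : Matrix (Fin M) (Fin M) 𝕜)
    (e : (Fin M × Fin M) ⊕ (Fin M × Fin M)) :
    hirotaDerivation B (hirotaDerivation B' (MvPolynomial.X e)) =
      Sum.elim
        (fun e => ∑ r, MvPolynomial.C ((B' * B) e.1 r) * MvPolynomial.X (Sum.inl (r, e.2)))
        (fun e => ∑ r, MvPolynomial.C ((B' * B) e.1 r) * MvPolynomial.X (Sum.inr (r, e.2))) e := by
  rcases e with e | e
  · simp only [hirotaDerivation_X_inl, map_sum, derivation_C_mul, Finset.mul_sum, Sum.elim_inl,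
      Matrix.mul_apply, map_mul, Finset.sum_mul, mul_assoc]
    exact Finset.sum_comm
  · simp only [hirotaDerivation_X_inr, map_neg, map_sum, derivation_C_mul, Finset.mul_sum,
      Sum.elim_inr, Matrix.mul_apply, map_mul, Finset.sum_mul, mul_assoc, mul_neg,
      Finset.sum_neg_distrib, neg_neg]
    exact Finset.sum_comm

lemma hirotaDerivation_comm {B B' : Matrix (Fin M) (Fin M) 𝕜} (h : Commute B B')
    (f : EntryPoly 𝕜 M) :
    hirotaDerivation B (hirotaDerivation B' f) = hirotaDerivation B' (hirotaDerivation B f) := by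
  have h1 : ⁅hirotaDerivation B, hirotaDerivation B'⁆ = 0 := by
    refine MvPolynomial.derivation_ext fun e => ?_
    rw [Derivation.commutator_apply, hirotaDerivation_hirotaDerivation_X,
      hirotaDerivation_hirotaDerivation_X, h.eq, sub_self, Derivation.zero_apply]
  have h2 := congrArg (fun d : Derivation 𝕜 _ _ => d f) h1
  simpa [Derivation.commutator_apply, sub_eq_zero] using h2

/-- The operators `(1/n) D_n` on polynomials in the entries of two generic matrices. -/
noncomputable def hirotaOperator (A : Matrix (Fin M) (Fin M) 𝕜) (n : ℕ+) :
    Module.End 𝕜 (EntryPoly 𝕜 M) :=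
  ((n : ℕ) : 𝕜)⁻¹ • (hirotaDerivation (A ^ (n : ℕ))).toLinearMap

lemma hirotaOperator_apply (A : Matrix (Fin M) (Fin M) 𝕜) (n : ℕ+) (f : EntryPoly 𝕜 M) :
    hirotaOperator A n f = ((n : ℕ) : 𝕜)⁻¹ • hirotaDerivation (A ^ (n : ℕ)) f :=
  rfl

lemma commute_hirotaOperator (A : Matrix (Fin M) (Fin M) 𝕜) (m n : ℕ+) :
    Commute (hirotaOperator A m) (hirotaOperator A n) := by
  refine LinearMap.ext fun f => ?_
  simp only [Module.End.mul_apply, hirotaOperator_apply, Derivation.map_smul]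
  rw [hirotaDerivation_comm ((Commute.refl A).pow_pow _ _), smul_comm]

/-- Evaluation of a polynomial in the entries at a pair of matrices. -/
noncomputable def evalEntries (E E' : Matrix (Fin M) (Fin M) 𝕜) : EntryPoly 𝕜 M →ₐ[𝕜] 𝕜 :=
  MvPolynomial.aeval (Sum.elim (fun e => E e.1 e.2) fun e => E' e.1 e.2)

/-- The vertex operator substitution `X ↦ (1 - zA)⁻¹ E`, `Y ↦ (1 - zA) E'`. -/
noncomputable def vertexShift (A E E' : Matrix (Fin M) (Fin M) 𝕜) : EntryPoly 𝕜 M →ₐ[𝕜] 𝕜⟦X⟧ :=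
  MvPolynomial.aeval
    (Sum.elim (fun e => (resolvent A * E.map (C (R := 𝕜))) e.1 e.2)
      fun e => (oneSubX A * E'.map (C (R := 𝕜))) e.1 e.2)

lemma constantCoeff_vertexShift (A E E' : Matrix (Fin M) (Fin M) 𝕜) (f : EntryPoly 𝕜 M) :
    constantCoeff (vertexShift A E E' f) = evalEntries E E' f := by
  induction f using MvPolynomial.induction_on with
  | C c => simp [vertexShift, evalEntries]
  | add p q hp hq => simp only [map_add, hp, hq]
  | mul_X p e hp =>
    simp only [map_mul, hp]
    congr 1
    rcases e with e | e
    · simp [vertexShift, evalEntries, Matrix.mul_apply, resolvent, Matrix.one_apply]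
    · simp [vertexShift, evalEntries, Matrix.mul_apply, oneSubX_apply, Matrix.one_apply, apply_ite]

variable (A E E' : Matrix (Fin M) (Fin M) 𝕜)

lemma coeff_resolvent_mul_map (p q : Fin M) (n : ℕ) :
    coeff n ((resolvent A * E.map (C (R := 𝕜))) p q) = (A ^ n * E) p q := by
  simp [Matrix.mul_apply, coeff_mul_C, coeff_resolvent]

lemma vertexShift_hirotaDerivation_X_inl (B : Matrix (Fin M) (Fin M) 𝕜) (e : Fin M × Fin M) :
    vertexShift A E E' (hirotaDerivation B (MvPolynomial.X (Sum.inl e))) =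
      (B.map (C (R := 𝕜)) * (resolvent A * E.map (C (R := 𝕜)))) e.1 e.2 := by
  rw [hirotaDerivation_X_inl, map_sum, Matrix.mul_apply]
  refine Finset.sum_congr rfl fun r _ => ?_
  simp [vertexShift, MvPolynomial.algHom_C]

lemma vertexShift_hirotaDerivation_X_inr (B : Matrix (Fin M) (Fin M) 𝕜) (e : Fin M × Fin M) :
    vertexShift A E E' (hirotaDerivation B (MvPolynomial.X (Sum.inr e))) =
      -(B.map (C (R := 𝕜)) * (oneSubX A * E'.map (C (R := 𝕜)))) e.1 e.2 := by
  rw [hirotaDerivation_X_inr, map_neg, map_sum, Matrix.mul_apply]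
  congr 1
  refine Finset.sum_congr rfl fun r _ => ?_
  simp [vertexShift, MvPolynomial.algHom_C]

/-- The Euler operator `z d/dz` agrees with `∑ zᵏ D_k` under the vertex shift, to any order. -/
lemma X_pow_dvd_euler_sub (N : ℕ) (f : EntryPoly 𝕜 M) :
    (X : 𝕜⟦X⟧) ^ (N + 1) ∣ X * PowerSeries.derivative 𝕜 (vertexShift A E E' f) -
      ∑ k ∈ Finset.range N, X ^ (k + 1) *
        vertexShift A E E' (hirotaDerivation (A ^ (k + 1)) f) := by
  induction f using MvPolynomial.induction_on with
  | C c =>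
    have h1 : vertexShift A E E' (MvPolynomial.C c) = C c := by
      rw [vertexShift, MvPolynomial.aeval_C]
      rfl
    have h2 : ∀ B, hirotaDerivation (𝕜 := 𝕜) (M := M) B (MvPolynomial.C c) = 0 := fun B =>
      (hirotaDerivation B).map_algebraMap c
    simp [h1, h2]
  | add p q hp hq =>
    convert dvd_add hp hq using 1
    simp only [map_add, mul_add, Finset.sum_add_distrib]
    ring
  | mul_X p e hp =>
    have hgen : (X : 𝕜⟦X⟧) ^ (N + 1) ∣
        X * PowerSeries.derivative 𝕜 (vertexShift A E E' (MvPolynomial.X e)) -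
        ∑ k ∈ Finset.range N, X ^ (k + 1) *
        vertexShift A E E' (hirotaDerivation (A ^ (k + 1)) (MvPolynomial.X e)) := by
      rcases e with e | e
      · rw [X_pow_dvd_iff]
        intro m hm
        -- Each term with `k < m` yields the same entry of `A ^ m * E`, and there are `m` of them,
        -- as `z d/dz` demands.
        have h1 : ∀ k, coeff m ((X : 𝕜⟦X⟧) ^ (k + 1) * vertexShift A E E'
            (hirotaDerivation (A ^ (k + 1)) (MvPolynomial.X (Sum.inl e)))) =
            if k < m then (A ^ m * E) e.1 e.2 else 0 := by
          intro k
          rw [coeff_X_pow_mul', vertexShift_hirotaDerivation_X_inl, Matrix.mul_apply, map_sum]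
          simp only [Matrix.map_apply, coeff_C_mul, coeff_resolvent_mul_map, Nat.succ_le_iff]
          split_ifs with hk
          · rw [← Matrix.mul_apply, ← mul_assoc, ← pow_add, Nat.add_sub_cancel' hk]
          · rfl
        have h2 : vertexShift A E E' (MvPolynomial.X (Sum.inl e)) =
            (resolvent A * E.map (C (R := 𝕜))) e.1 e.2 := by
          simp [vertexShift]
        have h3 : (Finset.range N).filter (fun k => k < m) = Finset.range m := by
          ext k
          simp only [Finset.mem_filter, Finset.mem_range]
          omega
        rw [map_sub, map_sum, Finset.sum_congr rfl fun k _ => h1 k, ← Finset.sum_filter, h3,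
          Finset.sum_const, Finset.card_range, h2]
        cases m with
        | zero => simp
        | succ m =>
          rw [coeff_succ_X_mul, coeff_derivative, coeff_resolvent_mul_map, nsmul_eq_mul]
          push_cast
          ring
      · have h2 : vertexShift A E E' (MvPolynomial.X (Sum.inr e)) =
            (oneSubX A * E'.map (C (R := 𝕜))) e.1 e.2 := by
          simp [vertexShift]
        set Z : Matrix (Fin M) (Fin M) 𝕜⟦X⟧ := (X : 𝕜⟦X⟧) • A.map (C (R := 𝕜)) with hZ
        have hZk : ∀ k, Z ^ k = (X : 𝕜⟦X⟧) ^ k • (A ^ k).map (C (R := 𝕜)) := by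
          intro k
          rw [hZ, smul_pow, ← RingHom.mapMatrix_apply, ← RingHom.mapMatrix_apply, map_pow]
        -- In terms of `Z = zA` the sum telescopes from `Z` to `Z ^ (N + 1)`. The lower end matches
        -- the Euler derivative of `1 - Z`, and the upper end is the allowed error.
        have h1 : ∀ k, (X : 𝕜⟦X⟧) ^ (k + 1) * vertexShift A E E'
            (hirotaDerivation (A ^ (k + 1)) (MvPolynomial.X (Sum.inr e))) =
            (Z ^ (k + 2) * E'.map (C (R := 𝕜))) e.1 e.2 -
              (Z ^ (k + 1) * E'.map (C (R := 𝕜))) e.1 e.2 := by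
          intro k
          rw [vertexShift_hirotaDerivation_X_inr, mul_neg, ← smul_eq_mul, ← Matrix.smul_apply,
            ← Matrix.smul_mul, ← hZk, oneSubX, ← hZ, sub_mul, one_mul, mul_sub, ← mul_assoc,
            ← pow_succ, Matrix.sub_apply]
          ring
        have h3 : X * PowerSeries.derivative 𝕜 ((oneSubX A * E'.map (C (R := 𝕜))) e.1 e.2) =
            -(Z ^ 1 * E'.map (C (R := 𝕜))) e.1 e.2 := by
          rw [pow_one, hZ, Matrix.smul_mul, Matrix.smul_apply, smul_eq_mul, ← mul_neg]
          congr 1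
          simp [Matrix.mul_apply, oneSubX_apply, Matrix.one_apply, sub_mul,
            PowerSeries.derivative_C, ← map_mul, mul_assoc, Derivation.leibniz]
        rw [h2, h3, Finset.sum_congr rfl fun k _ => h1 k,
          Finset.sum_range_sub (fun k => (Z ^ (k + 1) * E'.map (C (R := 𝕜))) e.1 e.2)]
        refine ⟨-((A ^ (N + 1)).map (C (R := 𝕜)) * E'.map (C (R := 𝕜))) e.1 e.2, ?_⟩
        rw [hZk (N + 1), Matrix.smul_mul, Matrix.smul_apply, smul_eq_mul, zero_add]
        ring
    -- Both operators being compared obey the Leibniz rule along the vertex shift, so the error for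
    -- a product is a combination of the two errors.
    convert dvd_add (hp.mul_left (vertexShift A E E' (MvPolynomial.X e)))
      (hgen.mul_left (vertexShift A E E' p)) using 1
    simp only [map_mul, Derivation.leibniz, smul_eq_mul, map_add, mul_sub, mul_add,
      Finset.mul_sum, Finset.sum_add_distrib]
    have : ∀ a b c d s1 s2 s3 s4 : 𝕜⟦X⟧, a = c → b = d → s1 = s3 → s2 = s4 →
        a + b - (s1 + s2) = d - s4 + (c - s3) := by
      rintro a b c d s1 s2 s3 s4 rfl rfl rfl rfl
      ring
    refine this _ _ _ _ _ _ _ _ (by ring) (by ring)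
      (Finset.sum_congr rfl fun k _ => by ring) (Finset.sum_congr rfl fun k _ => by ring)

/-- The elementary Schur polynomials in the operators `(1/n) D_n` are the coefficients of the
vertex shift. -/
theorem coeff_vertexShift [CharZero 𝕜] (m : ℕ) (f : EntryPoly 𝕜 M) :
    coeff m (vertexShift A E E' f) =
      evalEntries E E' (schurOperator 𝕜 (fun k => hirotaOperator A k.succPNat) m m f) := by
  induction m using Nat.strong_induction_on generalizing f with
  | _ m ih =>
    rcases Nat.eq_zero_or_pos m with rfl | hm
    · rw [coeff_zero_eq_constantCoeff_apply, constantCoeff_vertexShift, schurOperator_zero,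
        Module.End.one_apply]
    have hm' : (m : 𝕜) ≠ 0 := Nat.cast_ne_zero.2 hm.ne'
    refine mul_left_cancel₀ hm' ?_
    have hcomm : ∀ a b : ℕ, Commute (hirotaOperator A a.succPNat) (hirotaOperator A b.succPNat) :=
      fun a b => commute_hirotaOperator A _ _
    have h := congrArg (fun T => evalEntries E E' (T f)) (smul_schurOperator (𝕜 := 𝕜)
      (x := fun k => hirotaOperator A k.succPNat) hcomm m)
    simp only [LinearMap.smul_apply, map_smul, smul_eq_mul, LinearMap.sum_apply, map_sum] at h
    rw [h]
    -- Reading off the coefficient of `zᵐ` gives the vertex shift the same recursion as the Schur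
    -- operators.
    have h2 := X_pow_dvd_iff.1 (X_pow_dvd_euler_sub A E E' m f) m (Nat.lt_succ_self m)
    rw [map_sub, sub_eq_zero, map_sum] at h2
    have h3 : coeff m (X * PowerSeries.derivative 𝕜 (vertexShift A E E' f)) =
        m * coeff m (vertexShift A E E' f) := by
      obtain ⟨n, rfl⟩ := Nat.exists_eq_succ_of_ne_zero hm.ne'
      rw [Nat.succ_eq_add_one, coeff_succ_X_mul, coeff_derivative]
      push_cast
      ring
    rw [← h3, h2]
    refine Finset.sum_congr rfl fun k hk => ?_
    have hk' : k + 1 ≤ m := Finset.mem_range.1 hk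
    rw [coeff_X_pow_mul', if_pos hk', ih _ (by omega),
      (Commute.schurOperator_right (fun a => hcomm k a) _ _).eq, Module.End.mul_apply]
    have h4 : hirotaDerivation (A ^ (k + 1)) f =
        ((k + 1 : ℕ) : 𝕜) • hirotaOperator A k.succPNat f := by
      have : ((k + 1 : ℕ) : 𝕜) ≠ 0 := Nat.cast_ne_zero.2 (Nat.succ_ne_zero _)
      rw [hirotaOperator_apply, smul_smul, Nat.succPNat_coe, Nat.succ_eq_add_one,
        mul_inv_cancel₀ this, one_smul]
    rw [h4, map_smul, map_smul, smul_eq_mul]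

end Vertex

/-! ### The tau function formula from a factorization -/

section TauFunctions

variable {𝕜 : Type*} [RCLike 𝕜] {M : ℕ}

/-- The multi-times at which `Θ_A` converges. -/
def convergenceTimes (A : Matrix (Fin M) (Fin M) 𝕜) : Set (Times 𝕜) :=
  {t | Summable fun n : ℕ+ => t n • A ^ (n : ℕ)}

lemma hasSum_timeDir (A : Matrix (Fin M) (Fin M) 𝕜) (n : ℕ+) (s : 𝕜) :
    HasSum (fun m : ℕ+ => (s • timeDir 𝕜 n) m • A ^ (m : ℕ)) (s • A ^ (n : ℕ)) := by
  convert hasSum_single (f := fun m : ℕ+ => (s • timeDir 𝕜 n) m • A ^ (m : ℕ)) n ?_ using 1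
  · simp [timeDir]
  · intro m hm
    simp [timeDir, hm]

lemma hasSum_add_timeDir {A : Matrix (Fin M) (Fin M) 𝕜} {t : Times 𝕜}
    (ht : t ∈ convergenceTimes A) (n : ℕ+) (s : 𝕜) :
    HasSum (fun m : ℕ+ => (t + s • timeDir 𝕜 n) m • A ^ (m : ℕ))
      (theta A t + s • A ^ (n : ℕ)) := by
  have h : HasSum _ (theta A t + s • A ^ (n : ℕ)) :=
    HasSum.add (f := fun m : ℕ+ => t m • A ^ (m : ℕ)) ht.hasSum (hasSum_timeDir A n s)
  convert h using 1
  ext1 m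
  rw [Pi.add_apply, add_smul]

/-- The domain of convergence need not be open, but it is stable under changing a single time, which
is all that line derivatives need. -/
lemma add_timeDir_mem {A : Matrix (Fin M) (Fin M) 𝕜} {t : Times 𝕜}
    (ht : t ∈ convergenceTimes A) (n : ℕ+) (s : 𝕜) :
    t + s • timeDir 𝕜 n ∈ convergenceTimes A :=
  (hasSum_add_timeDir ht n s).summable

lemma theta_add_timeDir {A : Matrix (Fin M) (Fin M) 𝕜} {t : Times 𝕜}
    (ht : t ∈ convergenceTimes A) (n : ℕ+) (s : 𝕜) :
    theta A (t + s • timeDir 𝕜 n) = theta A t + s • A ^ (n : ℕ) :=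
  (hasSum_add_timeDir ht n s).tsum_eq

lemma commute_theta (A : Matrix (Fin M) (Fin M) 𝕜) (t : Times 𝕜) : Commute A (theta A t) := by
  by_cases ht : t ∈ convergenceTimes A
  · exact Commute.tsum_right A fun n => ((Commute.refl A).pow_right _).smul_right _
  · rw [theta, tsum_eq_zero_of_not_summable ht]
    exact Commute.zero_right A

attribute [local instance] Matrix.linftyOpNormedRing Matrix.linftyOpNormedAlgebra in
lemma hasDerivAt_exp_smul_mul_apply (B E : Matrix (Fin M) (Fin M) 𝕜) (p q : Fin M) :
    HasDerivAt (fun s : 𝕜 => (NormedSpace.exp (s • B) * E) p q) ((B * E) p q) 0 := by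
  have h := (hasDerivAt_exp_smul_const (𝕂 := 𝕜) B 0).mul_const E
  rw [zero_smul, NormedSpace.exp_zero, one_mul] at h
  exact (LinearMap.toContinuousLinearMap
    (Matrix.entryLinearMap 𝕜 𝕜 p q)).hasFDerivAt.comp_hasDerivAt (0 : 𝕜) h

lemma exp_theta_add_timeDir {A : Matrix (Fin M) (Fin M) 𝕜} {t : Times 𝕜}
    (ht : t ∈ convergenceTimes A) (n : ℕ+) (s : 𝕜) :
    NormedSpace.exp (theta A (t + s • timeDir 𝕜 n)) =
      NormedSpace.exp (s • A ^ (n : ℕ)) * NormedSpace.exp (theta A t) := by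
  rw [theta_add_timeDir ht, add_comm, Matrix.exp_add_of_commute]
  exact ((commute_theta A t).pow_left _).smul_left _

/-- Chain rule for polynomials in finitely many functions, in terms of a derivation. -/
lemma hasDerivAt_aeval {σ : Type*} (d : Derivation 𝕜 (MvPolynomial σ 𝕜) (MvPolynomial σ 𝕜))
    {y : 𝕜 → σ → 𝕜} {s : 𝕜}
    (h : ∀ e, HasDerivAt (fun s => y s e) (MvPolynomial.aeval (y s) (d (MvPolynomial.X e))) s)
    (f : MvPolynomial σ 𝕜) :
    HasDerivAt (fun s => MvPolynomial.aeval (y s) f) (MvPolynomial.aeval (y s) (d f)) s := by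
  induction f using MvPolynomial.induction_on with
  | C c =>
    have h0 : d (MvPolynomial.C c) = 0 := d.map_algebraMap c
    simpa [h0] using hasDerivAt_const s c
  | add p q hp hq =>
    simp only [map_add]
    exact hp.add hq
  | mul_X p e hp =>
    have := hp.mul (h e)
    simp only [map_mul, MvPolynomial.aeval_X, Derivation.leibniz, map_add, smul_eq_mul]
    exact this.congr_deriv (by ring)

/-- The values of a polynomial in the entries at the exponentials of `Θ(𝐭)` and `Θ(𝐭')`. -/
noncomputable def evalExp (A : Matrix (Fin M) (Fin M) 𝕜) (x : Times 𝕜 × Times 𝕜) :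
    EntryPoly 𝕜 M →ₐ[𝕜] 𝕜 :=
  evalEntries (NormedSpace.exp (theta A x.1)) (NormedSpace.exp (theta A x.2))

lemma leftDerivation_X_inl (B : Matrix (Fin M) (Fin M) 𝕜) (e : Fin M × Fin M) :
    leftDerivation B (MvPolynomial.X (Sum.inl e)) =
      ∑ r, MvPolynomial.C (B e.1 r) * MvPolynomial.X (Sum.inl (r, e.2)) := by
  simp [leftDerivation, MvPolynomial.mkDerivation_X]

lemma lineDeriv_evalExp_left {A : Matrix (Fin M) (Fin M) 𝕜} {x : Times 𝕜 × Times 𝕜}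
    (hx : x.1 ∈ convergenceTimes A) (n : ℕ+) (f : EntryPoly 𝕜 M) :
    HasDerivAt (fun s : 𝕜 => evalExp A (x + s • (timeDir 𝕜 n, 0)) f)
      (evalExp A x (leftDerivation (A ^ (n : ℕ)) f)) 0 := by
  have h := hasDerivAt_aeval (leftDerivation (A ^ (n : ℕ))) (s := 0)
    (y := fun s => Sum.elim
      (fun e => (NormedSpace.exp (s • A ^ (n : ℕ)) * NormedSpace.exp (theta A x.1)) e.1 e.2)
      (fun e => NormedSpace.exp (theta A x.2) e.1 e.2)) ?_ f
  · simpa only [evalExp, evalEntries, Prod.fst_add, Prod.smul_fst, exp_theta_add_timeDir hx,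
      Prod.snd_add, Prod.smul_snd, smul_zero, add_zero, zero_smul, NormedSpace.exp_zero,
      one_mul] using h
  · rintro (e | e)
    · refine (hasDerivAt_exp_smul_mul_apply (A ^ (n : ℕ))
        (NormedSpace.exp (theta A x.1)) e.1 e.2).congr_deriv ?_
      rw [leftDerivation_X_inl, map_sum, Matrix.mul_apply]
      simp
    · simpa [leftDerivation, MvPolynomial.mkDerivation_X] using hasDerivAt_const (0 : 𝕜) _

lemma rightDerivation_X_inr (B : Matrix (Fin M) (Fin M) 𝕜) (e : Fin M × Fin M) :
    rightDerivation B (MvPolynomial.X (Sum.inr e)) =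
      ∑ r, MvPolynomial.C (B e.1 r) * MvPolynomial.X (Sum.inr (r, e.2)) := by
  simp [rightDerivation, MvPolynomial.mkDerivation_X]

lemma lineDeriv_evalExp_right {A : Matrix (Fin M) (Fin M) 𝕜} {x : Times 𝕜 × Times 𝕜}
    (hx : x.2 ∈ convergenceTimes A) (n : ℕ+) (f : EntryPoly 𝕜 M) :
    HasDerivAt (fun s : 𝕜 => evalExp A (x + s • (0, timeDir 𝕜 n)) f)
      (evalExp A x (rightDerivation (A ^ (n : ℕ)) f)) 0 := by
  have h := hasDerivAt_aeval (rightDerivation (A ^ (n : ℕ))) (s := 0)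
    (y := fun s => Sum.elim (fun e => NormedSpace.exp (theta A x.1) e.1 e.2)
      (fun e => (NormedSpace.exp (s • A ^ (n : ℕ)) * NormedSpace.exp (theta A x.2)) e.1 e.2)) ?_ f
  · simpa only [evalExp, evalEntries, Prod.fst_add, Prod.smul_fst, exp_theta_add_timeDir hx,
      Prod.snd_add, Prod.smul_snd, smul_zero, add_zero, zero_smul, NormedSpace.exp_zero,
      one_mul] using h
  · rintro (e | e)
    · simpa [rightDerivation, MvPolynomial.mkDerivation_X] using hasDerivAt_const (0 : 𝕜) _
    · refine (hasDerivAt_exp_smul_mul_apply (A ^ (n : ℕ))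
        (NormedSpace.exp (theta A x.2)) e.1 e.2).congr_deriv ?_
      rw [rightDerivation_X_inr, map_sum, Matrix.mul_apply]
      simp

/-- `F` is given on the domain of convergence by the polynomial `f` in the entries of the
exponentials. -/
def IsRepresentedBy (A : Matrix (Fin M) (Fin M) 𝕜) (F : Times 𝕜 × Times 𝕜 → 𝕜)
    (f : EntryPoly 𝕜 M) : Prop :=
  ∀ x : Times 𝕜 × Times 𝕜, x.1 ∈ convergenceTimes A → x.2 ∈ convergenceTimes A →
    F x = evalExp A x f

/-- Changing `t_n` multiplies the exponential on the left by `exp (s A^n)`, so the derivative is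
again given by a polynomial in the entries. -/
lemma IsRepresentedBy.hirotaDTilde {A : Matrix (Fin M) (Fin M) 𝕜} {F : Times 𝕜 × Times 𝕜 → 𝕜}
    {f : EntryPoly 𝕜 M} (h : IsRepresentedBy A F f) (n : ℕ+) :
    IsRepresentedBy A (hirotaDTilde n F) (hirotaOperator A n f) := by
  intro x h1 h2
  have e1 : (fun s : 𝕜 => F (x + s • (timeDir 𝕜 n, 0))) =
      fun s => evalExp A (x + s • (timeDir 𝕜 n, 0)) f := by
    ext s
    refine h _ ?_ ?_
    · exact add_timeDir_mem h1 n s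
    · simpa using h2
  have e2 : (fun s : 𝕜 => F (x + s • (0, timeDir 𝕜 n))) =
      fun s => evalExp A (x + s • (0, timeDir 𝕜 n)) f := by
    ext s
    refine h _ ?_ ?_
    · simpa using h1
    · exact add_timeDir_mem h2 n s
  rw [FullKostantToda.hirotaDTilde, Pi.smul_apply, hirotaD, lineDeriv, lineDeriv, e1, e2,
    (lineDeriv_evalExp_left h1 n f).deriv, (lineDeriv_evalExp_right h2 n f).deriv,
    hirotaOperator_apply, map_smul, hirotaDerivation, Derivation.sub_apply, map_sub]

lemma evalExp_minor (A : Matrix (Fin M) (Fin M) 𝕜) (x : Times 𝕜 × Times 𝕜) (N N' : ℕ) :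
    evalExp A x (minor (genericLeft 𝕜 M) N * minor (genericRight 𝕜 M) N') =
      tau A N x.1 * tau A N' x.2 := by
  rw [map_mul, minor, minor, AlgHom.map_det, AlgHom.map_det, tau, tau, leadingMinor, leadingMinor]
  congr 2 <;>
  · ext p q
    simp [evalExp, evalEntries, genericLeft, genericRight, Matrix.toSquareBlockProp_def]

lemma vertexShift_minor (A E E' : Matrix (Fin M) (Fin M) 𝕜) (N N' : ℕ) :
    vertexShift A E E' (minor (genericLeft 𝕜 M) N * minor (genericRight 𝕜 M) N') =
      minor (resolvent A * E.map (PowerSeries.C (R := 𝕜))) N *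
        minor (oneSubX A * E'.map (PowerSeries.C (R := 𝕜))) N' := by
  rw [map_mul, minor, minor, AlgHom.map_det, AlgHom.map_det]
  congr 2 <;>
  · ext1 p q
    simp [vertexShift, genericLeft, genericRight, Matrix.toSquareBlockProp_def]

lemma schurHirota_tau {A : Matrix (Fin M) (Fin M) 𝕜} {t : Times 𝕜} (ht : t ∈ convergenceTimes A)
    (m N N' : ℕ) :
    schurHirota m (tau A N) (tau A N') t =
      PowerSeries.coeff m
        (minor (resolvent A * (NormedSpace.exp (theta A t)).map (PowerSeries.C (R := 𝕜))) N *
          minor (oneSubX A * (NormedSpace.exp (theta A t)).map (PowerSeries.C (R := 𝕜))) N') := by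
  have hrep : IsRepresentedBy A (fun x => tau A N x.1 * tau A N' x.2)
      (minor (genericLeft 𝕜 M) N * minor (genericRight 𝕜 M) N') :=
    fun x _ _ => (evalExp_minor A x N N').symm
  -- Line derivatives are not linear on arbitrary functions, so the expression is moved to the
  -- polynomial ring, where the operators are linear and commute.
  have h := elemSchurApply_rel (𝕜 := 𝕜) (IsRepresentedBy A)
    (fun x _ _ => by simp)
    (fun a a' b b' ha hb x h1 h2 => by rw [Pi.add_apply, ha x h1 h2, hb x h1 h2, map_add])
    (fun c a a' ha x h1 h2 => by rw [Pi.smul_apply, ha x h1 h2, map_smul])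
    hirotaDTilde (fun n => ⇑(hirotaOperator A n)) (fun n _ _ h => h.hirotaDTilde n) m hrep
  rw [schurHirota, h (t, t) ht ht, elemSchurApply_linear, evalExp, ← coeff_vertexShift,
    vertexShift_minor]

lemma resolvent_mul_map {A L u : Matrix (Fin M) (Fin M) 𝕜} (h : A * u = u * L) :
    resolvent A * u.map (PowerSeries.C (R := 𝕜)) = u.map (PowerSeries.C (R := 𝕜)) * resolvent L := by
  have hpow : ∀ n : ℕ, A ^ n * u = u * L ^ n := fun n => by
    induction n with
    | zero => simp
    | succ n ih => rw [pow_succ, mul_assoc, h, ← mul_assoc, ih, mul_assoc, ← pow_succ]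
  ext p q n
  rw [coeff_resolvent_mul_map, hpow, Matrix.mul_apply, Matrix.mul_apply, map_sum]
  simp [coeff_resolvent]

lemma oneSubX_mul_map {A L u : Matrix (Fin M) (Fin M) 𝕜} (h : A * u = u * L) :
    oneSubX A * u.map (PowerSeries.C (R := 𝕜)) = u.map (PowerSeries.C (R := 𝕜)) * oneSubX L := by
  rw [oneSubX, oneSubX, sub_mul, mul_sub, one_mul, mul_one, Matrix.smul_mul, Matrix.mul_smul,
    ← Matrix.map_mul, ← Matrix.map_mul, h]

lemma IsLowerUnipotent.isUnit {u : Matrix (Fin M) (Fin M) 𝕜} (hu : IsLowerUnipotent u) :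
    IsUnit u := by
  rw [Matrix.isUnit_iff_isUnit_det, Matrix.det_of_isLowerTriangular]
  · simp [hu.1]
  · exact fun i j hij => hu.2 i j hij

lemma IsLowerUnipotent.mul {u v : Matrix (Fin M) (Fin M) 𝕜} (hu : IsLowerUnipotent u)
    (hv : IsLowerUnipotent v) : IsLowerUnipotent (u * v) := by
  have h : ∀ i j r : Fin M, i ≤ j → r ≠ i ∨ r ≠ j → u i r * v r j = 0 := by
    intro i j r hij hr
    by_cases h1 : i < r
    · rw [hu.2 i r h1, zero_mul]
    · rw [hv.2 r j (by omega), mul_zero]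
  refine ⟨fun i => ?_, fun i j hij => ?_⟩
  · rw [Matrix.mul_apply, Finset.sum_eq_single i (fun r _ hr => h i i r le_rfl (Or.inl hr))
      (by simp), hu.1, hv.1, one_mul]
  · rw [Matrix.mul_apply]
    exact Finset.sum_eq_zero fun r _ => h i j r hij.le (by omega)

lemma IsHessenberg.mul_lower {A u : Matrix (Fin M) (Fin M) 𝕜} (hA : IsHessenberg A)
    (hu : IsLowerUnipotent u) : IsHessenberg (A * u) := by
  refine ⟨fun i j hij => ?_, fun i j hij => ?_⟩
  · rw [Matrix.mul_apply, Finset.sum_eq_single j, hA.1 i j hij, hu.1, one_mul]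
    · intro r _ hr
      by_cases h1 : (i : ℕ) + 1 < r
      · rw [hA.2 i r h1, zero_mul]
      · rw [hu.2 r j (by omega), mul_zero]
    · simp
  · rw [Matrix.mul_apply]
    refine Finset.sum_eq_zero fun r _ => ?_
    by_cases h1 : (i : ℕ) + 1 < r
    · rw [hA.2 i r h1, zero_mul]
    · rw [hu.2 r j (by omega), mul_zero]

lemma IsHessenberg.lower_mul {A u : Matrix (Fin M) (Fin M) 𝕜} (hA : IsHessenberg A)
    (hu : IsLowerUnipotent u) : IsHessenberg (u * A) := by
  refine ⟨fun i j hij => ?_, fun i j hij => ?_⟩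
  · rw [Matrix.mul_apply, Finset.sum_eq_single i, hA.1 i j hij, hu.1, one_mul]
    · intro r _ hr
      by_cases h1 : i < r
      · rw [hu.2 i r h1, zero_mul]
      · rw [hA.2 r j (by omega), mul_zero]
    · simp
  · rw [Matrix.mul_apply]
    refine Finset.sum_eq_zero fun r _ => ?_
    by_cases h1 : i < r
    · rw [hu.2 i r h1, zero_mul]
    · rw [hA.2 r j (by omega), mul_zero]

lemma IsLowerUnipotent.inv {u : Matrix (Fin M) (Fin M) 𝕜} (hu : IsLowerUnipotent u) :
    IsLowerUnipotent u⁻¹ := by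
  have hdet := (Matrix.isUnit_iff_isUnit_det u).1 hu.isUnit
  have := Matrix.invertibleOfIsUnitDet u hdet
  have hlow : Matrix.BlockTriangular u⁻¹ OrderDual.toDual :=
    Matrix.blockTriangular_inv_of_blockTriangular fun i j hij => hu.2 i j hij
  have hlow' : ∀ i j : Fin M, i < j → u⁻¹ i j = 0 := fun i j hij => hlow hij
  refine ⟨fun i => ?_, hlow'⟩
  have h := congrFun (congrFun (Matrix.mul_nonsing_inv u hdet) i) i
  rw [Matrix.mul_apply, Finset.sum_eq_single i, hu.1, one_mul, Matrix.one_apply_eq] at h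
  · exact h
  · intro r _ hr
    rcases lt_or_gt_of_ne hr with h1 | h1
    · rw [hlow' r i h1, mul_zero]
    · rw [hu.2 i r h1, zero_mul]
  · simp

/-- The factorization `exp Θ(𝐭) = u b` yields the `τ`-function formula for `u⁻¹ L₀ u`. -/
theorem hasTauEntries_of_factorization {L₀ : Matrix (Fin M) (Fin M) 𝕜} (hL₀ : IsHessenberg L₀)
    {t : Times 𝕜} (ht : Summable fun n : ℕ+ => t n • L₀ ^ (n : ℕ))
    {u b : Matrix (Fin M) (Fin M) 𝕜} (hu : IsLowerUnipotent u) (hb : IsUpperInvertible b)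
    (h : NormedSpace.exp (theta L₀ t) = u * b) : HasTauEntries L₀ t (u⁻¹ * L₀ * u) := by
  have hdet := (Matrix.isUnit_iff_isUnit_det u).1 hu.isUnit
  have htau : ∀ N, tau L₀ N t = minor b N := by
    intro N
    rw [tau, h]
    change minor (u * b) N = _
    rw [minor_mul_left hu.2, minor_eq_one_of_lower hu.1 hu.2, one_mul]
  have hne : ∀ N, tau L₀ N t ≠ 0 := fun N => by
    rw [htau]
    exact (isUnit_minor_of_upper hb.1 hb.2 N).ne_zero
  refine ⟨fun N _ => hne N, fun i j hij => ?_⟩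
  set L := u⁻¹ * L₀ * u with hL
  have hHess : IsHessenberg L := (hL₀.lower_mul hu.inv).mul_lower hu
  have hconj : L₀ * u = u * L := by
    rw [hL, ← mul_assoc, ← mul_assoc, Matrix.mul_nonsing_inv u hdet, one_mul]
  -- The outer factors leave the minors: `u` with value one, `b` with value the `τ`-function.
  have hmap : ∀ (N : ℕ) (Z : Matrix (Fin M) (Fin M) (PowerSeries 𝕜)),
      minor (u.map (PowerSeries.C (R := 𝕜)) * Z * b.map (PowerSeries.C (R := 𝕜))) N =
        minor Z N * PowerSeries.C (tau L₀ N t) := by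
    intro N Z
    rw [minor_of_lower_mul_mul_upper (fun i => by simp [hu.1]) (fun i j hij => by simp [hu.2 i j hij])
      (fun i j hij => by simp [hb.2 i j hij]), htau, minor, minor, minor, RingHom.map_det]
    rfl
  rw [eq_div_iff (mul_ne_zero (hne _) (hne _)), schurHirota_tau ht, h, Matrix.map_mul,
    ← mul_assoc (resolvent L₀), ← mul_assoc (oneSubX L₀), resolvent_mul_map hconj,
    oneSubX_mul_map hconj, hmap, hmap,
    mul_mul_mul_comm, ← map_mul, PowerSeries.coeff_mul_C,
    coeff_minor_resolvent_mul_minor_oneSubX hHess.1 hHess.2 hij]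

end TauFunctions

/-! ### Local existence and uniqueness for linear equations -/

section LinearODE

open Filter Topology

variable {E : Type*} [NormedAddCommGroup E] [NormedSpace ℝ E]

/-- Local existence for linear differential equations. -/
lemma exists_hasDerivAt_linear [CompleteSpace E] {T : ℝ → E →L[ℝ] E} {x₀ : ℝ}
    (hT : ∀ᶠ x in 𝓝 x₀, ContinuousAt T x) (y₀ : E) :
    ∃ y : ℝ → E, y x₀ = y₀ ∧ ∀ᶠ x in 𝓝 x₀, HasDerivAt y (T x (y x)) x := by
  have hbd : ∀ᶠ x in 𝓝 x₀, ‖T x‖₊ < ‖T x₀‖₊ + 1 :=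
    hT.self_of_nhds.nnnorm.eventually (gt_mem_nhds (lt_add_one _))
  obtain ⟨δ, hδ, hball⟩ := Metric.eventually_nhds_iff_ball.1 (hT.and hbd)
  -- `K` is the Lipschitz constant and `L` bounds the field on the unit ball around `y₀`; the choice
  -- of `η` below ensures `L η ≤ 1`, so the solution stays in that ball.
  set K : NNReal := ‖T x₀‖₊ + 1 with hK
  set L : NNReal := K * (‖y₀‖₊ + 1) with hL
  have hLpos : (0 : ℝ) < L := by
    rw [hL, hK]
    push_cast
    positivity
  set η := min (δ / 2) (1 / (L : ℝ)) with hη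
  have hηpos : 0 < η := lt_min (by positivity) (by positivity)
  have hsub : ∀ x ∈ Set.Icc (x₀ - η) (x₀ + η), x ∈ Metric.ball x₀ δ := by
    intro x hx
    have : η ≤ δ / 2 := min_le_left _ _
    rw [Metric.mem_ball, Real.dist_eq, abs_lt]
    constructor <;> linarith [hx.1, hx.2]
  have hPL : IsPicardLindelof (fun x y => T x y) (tmin := x₀ - η) (tmax := x₀ + η)
      ⟨x₀, by constructor <;> linarith⟩ y₀ 1 0 L K := by
    refine ⟨fun x hx => ?_, fun y _ => ?_, fun x hx y hy => ?_, ?_⟩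
    · have h : ‖T x‖₊ ≤ K := (hball x (hsub x hx)).2.le
      exact ((T x).lipschitz.weaken h).lipschitzOnWith
    · intro x hx
      have h : ContinuousAt T x := (hball x (hsub x hx)).1
      exact (h.clm_apply continuousAt_const).continuousWithinAt
    · have h : ‖T x‖ ≤ K := NNReal.coe_le_coe.2 (hball x (hsub x hx)).2.le
      have hy' : ‖y‖ ≤ ‖y₀‖ + 1 := by
        have h1 : dist y y₀ ≤ 1 := by simpa using hy
        rw [dist_eq_norm] at h1
        calc ‖y‖ = ‖y₀ + (y - y₀)‖ := by simp
          _ ≤ ‖y₀‖ + ‖y - y₀‖ := norm_add_le _ _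
          _ ≤ _ := by linarith
      calc ‖T x y‖ ≤ ‖T x‖ * ‖y‖ := (T x).le_opNorm y
        _ ≤ K * (‖y₀‖ + 1) := by gcongr
        _ = L := by simp [hL]
    · have h1 : η ≤ 1 / (L : ℝ) := min_le_right _ _
      have h2 : (L : ℝ) * η ≤ 1 := by
        calc (L : ℝ) * η ≤ L * (1 / L) := by gcongr
          _ = 1 := by field_simp
      simpa using h2
  obtain ⟨y, hy0, hy⟩ := hPL.exists_eq_forall_mem_Icc_hasDerivWithinAt₀
  refine ⟨y, hy0, ?_⟩
  filter_upwards [Icc_mem_nhds (a := x₀ - η) (b := x₀ + η) (by linarith) (by linarith),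
    Ioo_mem_nhds (a := x₀ - η) (b := x₀ + η) (by linarith) (by linarith)] with x hx hx'
  exact (hy x hx).hasDerivAt (Icc_mem_nhds hx'.1 hx'.2)

/-- Local uniqueness of the zero solution of a linear differential equation. -/
lemma eventually_eq_zero_of_hasDerivAt_linear {T : ℝ → E →L[ℝ] E} {x₀ : ℝ}
    (hT : ContinuousAt T x₀) {y : ℝ → E} (hy : ∀ᶠ x in 𝓝 x₀, HasDerivAt y (T x (y x)) x)
    (h0 : y x₀ = 0) : ∀ᶠ x in 𝓝 x₀, y x = 0 := by
  have hbd : ∀ᶠ x in 𝓝 x₀, ‖T x‖₊ < ‖T x₀‖₊ + 1 :=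
    hT.nnnorm.eventually (gt_mem_nhds (lt_add_one _))
  refine ODE_solution_unique_of_eventually (v := fun x y => T x y) (s := fun _ => Set.univ)
    (K := ‖T x₀‖₊ + 1) (g := fun _ => (0 : E)) ?_ ?_ ?_ h0
  · filter_upwards [hbd] with x hx
    exact ((T x).lipschitz.weaken hx.le).lipschitzOnWith
  · filter_upwards [hy] with x hx
    exact ⟨hx, trivial⟩
  · refine Eventually.of_forall fun x => ⟨?_, trivial⟩
    simpa using hasDerivAt_const x (0 : E)

lemma eventually_eq_of_hasDerivAt_zero {x₀ : ℝ} {y : ℝ → E}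
    (hy : ∀ᶠ x in 𝓝 x₀, HasDerivAt y 0 x) : ∀ᶠ x in 𝓝 x₀, y x = y x₀ := by
  have h := eventually_eq_zero_of_hasDerivAt_linear (T := fun _ => 0) (x₀ := x₀)
    continuousAt_const (y := fun x => y x - y x₀)
    (hy.mono fun x hx => by simpa using hx.sub_const (y x₀)) (sub_self _)
  exact h.mono fun x hx => sub_eq_zero.1 hx

end LinearODE

/-! ### Gauge transformation of a Lax equation -/

section LaxEquation

open Filter Topology

variable {𝔸 : Type*} [NormedRing 𝔸] [NormedAlgebra ℝ 𝔸] [CompleteSpace 𝔸]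

/-- Gauge transformation of a Lax equation `ℓ' = [β, ℓ]`: with `b' = βb` and `d = b⁻¹`, `ℓ` is
conjugate to its initial value, and `u = exp((x - x₀) μ(x₀)) d` satisfies `u' = u (μ - β)` for
each `μ` that is conjugated along with `ℓ`. -/
lemma exists_gauge_of_lax {x₀ : ℝ} {ℓ β μ : ℝ → 𝔸} (hβ : ∀ᶠ x in 𝓝 x₀, ContinuousAt β x)
    (hℓ : ∀ᶠ x in 𝓝 x₀, HasDerivAt ℓ (β x * ℓ x - ℓ x * β x) x)
    (hμ : ∀ x d, ℓ x₀ * d = d * ℓ x → μ x₀ * d = d * μ x) :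
    ∃ b d : ℝ → 𝔸, b x₀ = 1 ∧ d x₀ = 1 ∧ ∀ᶠ x in 𝓝 x₀,
      HasDerivAt b (β x * b x) x ∧ d x * b x = 1 ∧ b x * d x = 1 ∧ ℓ x₀ * d x = d x * ℓ x ∧
      HasDerivAt (fun x => NormedSpace.exp ((x - x₀) • μ x₀) * d x)
        (NormedSpace.exp ((x - x₀) • μ x₀) * d x * (μ x - β x)) x := by
  obtain ⟨b, hb0, hb⟩ := exists_hasDerivAt_linear (T := fun x => ContinuousLinearMap.mul ℝ 𝔸 (β x))
    (hβ.mono fun x hx => (ContinuousLinearMap.mul ℝ 𝔸).continuous.continuousAt.comp hx) 1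
  obtain ⟨d, hd0, hd⟩ := exists_hasDerivAt_linear
    (T := fun x => -(ContinuousLinearMap.mul ℝ 𝔸).flip (β x))
    (hβ.mono fun x hx =>
      ((ContinuousLinearMap.mul ℝ 𝔸).flip.continuous.continuousAt.comp hx).neg) 1
  simp only [ContinuousLinearMap.mul_apply', neg_apply,
    ContinuousLinearMap.flip_apply] at hb hd
  have h1 : ∀ᶠ x in 𝓝 x₀, d x * b x = 1 := by
    have := eventually_eq_of_hasDerivAt_zero (y := fun x => d x * b x) (x₀ := x₀) (by
      filter_upwards [hb, hd] with x hbx hdx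
      refine (hdx.mul hbx).congr_deriv ?_
      noncomm_ring)
    simpa [hb0, hd0] using this
  -- Unlike `d b`, the product `b d` has no evidently zero derivative; but `b d - 1` solves the
  -- homogeneous equation `w' = [β, w]` with initial value zero.
  have h2 : ∀ᶠ x in 𝓝 x₀, b x * d x = 1 := by
    have h := eventually_eq_zero_of_hasDerivAt_linear (x₀ := x₀) (y := fun x => b x * d x - 1)
      (T := fun x => ContinuousLinearMap.mul ℝ 𝔸 (β x) -
        (ContinuousLinearMap.mul ℝ 𝔸).flip (β x))
      (((ContinuousLinearMap.mul ℝ 𝔸).continuous.continuousAt.comp hβ.self_of_nhds).sub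
        ((ContinuousLinearMap.mul ℝ 𝔸).flip.continuous.continuousAt.comp hβ.self_of_nhds))
      (by
        filter_upwards [hb, hd] with x hbx hdx
        refine ((hbx.mul hdx).sub_const 1).congr_deriv ?_
        simp only [sub_apply, ContinuousLinearMap.mul_apply',
          ContinuousLinearMap.flip_apply]
        noncomm_ring) (by simp [hb0, hd0])
    exact h.mono fun x hx => sub_eq_zero.1 hx
  have h3 : ∀ᶠ x in 𝓝 x₀, d x * ℓ x * b x = ℓ x₀ := by
    have := eventually_eq_of_hasDerivAt_zero (y := fun x => d x * ℓ x * b x) (x₀ := x₀) (by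
      filter_upwards [hb, hd, hℓ] with x hbx hdx hx
      refine ((hdx.mul hx).mul hbx).congr_deriv ?_
      simp only [Pi.mul_apply]
      noncomm_ring)
    simpa [hb0, hd0] using this
  refine ⟨b, d, hb0, hd0, ?_⟩
  filter_upwards [hb, hd, h1, h2, h3] with x hbx hdx h1 h2 h3
  have h4 : ℓ x₀ * d x = d x * ℓ x := by
    rw [← h3, mul_assoc, h2, mul_one]
  refine ⟨hbx, h1, h2, h4, ?_⟩
  have h5 := hμ x (d x) h4
  have hexp : HasDerivAt (fun x => NormedSpace.exp ((x - x₀) • μ x₀))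
      (NormedSpace.exp ((x - x₀) • μ x₀) * μ x₀) x := by
    have := (hasDerivAt_exp_smul_const (𝕂 := ℝ) (μ x₀) (x - x₀)).scomp x
      ((hasDerivAt_id x).sub_const x₀)
    simpa [Function.comp_def] using this
  refine (hexp.mul hdx).congr_deriv ?_
  rw [mul_assoc _ (μ x₀), h5]
  noncomm_ring

end LaxEquation

/-! ### Composing factorizations -/

section GaugeRelation

open Polynomial

variable {𝕜 : Type*} [RCLike 𝕜] {M : ℕ}

/-- `A'` is obtained from `A` by the factorization of `exp q(A)`. -/
def GaugeRel (q : 𝕜[X]) (A A' : Matrix (Fin M) (Fin M) 𝕜) : Prop :=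
  ∃ v c : Matrix (Fin M) (Fin M) 𝕜, IsLowerUnipotent v ∧ IsUpperInvertible c ∧
    NormedSpace.exp (aeval A q) = v * c ∧ A' = v⁻¹ * A * v

lemma IsUpperInvertible.inv {b : Matrix (Fin M) (Fin M) 𝕜} (hb : IsUpperInvertible b) :
    IsUpperInvertible b⁻¹ := by
  have hdet := (Matrix.isUnit_iff_isUnit_det b).1 hb.1
  have := Matrix.invertibleOfIsUnitDet b hdet
  have hup : Matrix.BlockTriangular b⁻¹ id :=
    Matrix.blockTriangular_inv_of_blockTriangular fun i j hij => hb.2 i j hij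
  exact ⟨(Matrix.isUnit_nonsing_inv_iff).2 hb.1, fun i j hij => hup hij⟩

lemma IsUpperInvertible.mul {b c : Matrix (Fin M) (Fin M) 𝕜} (hb : IsUpperInvertible b)
    (hc : IsUpperInvertible c) : IsUpperInvertible (b * c) := by
  refine ⟨hb.1.mul hc.1, fun i j hij => ?_⟩
  rw [Matrix.mul_apply]
  refine Finset.sum_eq_zero fun r _ => ?_
  by_cases h1 : r < i
  · rw [hb.2 i r h1, zero_mul]
  · rw [hc.2 r j (by omega), mul_zero]

lemma aeval_conj {A v : Matrix (Fin M) (Fin M) 𝕜} (hv : IsUnit v) (q : 𝕜[X]) :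
    aeval (v⁻¹ * A * v) q = v⁻¹ * aeval A q * v := by
  have hdet := (Matrix.isUnit_iff_isUnit_det v).1 hv
  have hpow : ∀ n : ℕ, (v⁻¹ * A * v) ^ n = v⁻¹ * A ^ n * v := fun n => by
    induction n with
    | zero => simp [Matrix.nonsing_inv_mul v hdet]
    | succ n ih =>
      rw [pow_succ, ih, pow_succ]
      calc v⁻¹ * A ^ n * v * (v⁻¹ * A * v) = v⁻¹ * A ^ n * (v * v⁻¹) * A * v := by noncomm_ring
        _ = _ := by rw [Matrix.mul_nonsing_inv v hdet]; noncomm_ring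
  induction q using Polynomial.induction_on' with
  | add p q hp hq => rw [map_add, map_add, hp, hq, mul_add, add_mul]
  | monomial n c =>
    rw [aeval_monomial, aeval_monomial, hpow, ← Algebra.smul_def, ← Algebra.smul_def,
      Matrix.mul_smul, Matrix.smul_mul]

/-- Conjugating `(v c)⁻¹` by `v` gives `v⁻¹ c⁻¹`, which is again a factorization of the required
type. -/
lemma GaugeRel.symm {q : 𝕜[X]} {A A' : Matrix (Fin M) (Fin M) 𝕜} (h : GaugeRel q A A') :
    GaugeRel (-q) A' A := by
  obtain ⟨v, c, hv, hc, he, rfl⟩ := h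
  have hdet := (Matrix.isUnit_iff_isUnit_det v).1 hv.isUnit
  refine ⟨v⁻¹, c⁻¹, hv.inv, hc.inv, ?_, ?_⟩
  · rw [aeval_conj hv.isUnit, map_neg, Matrix.exp_conj' _ _ hv.isUnit, Matrix.exp_neg, he,
      Matrix.mul_inv_rev, mul_assoc, mul_assoc, Matrix.nonsing_inv_mul v hdet, mul_one]
  · rw [Matrix.nonsing_inv_nonsing_inv v hdet]
    calc A = (v * v⁻¹) * A * (v * v⁻¹) := by rw [Matrix.mul_nonsing_inv v hdet]; simp
      _ = _ := by noncomm_ring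

/-- Conjugation by `v` turns the second exponential into one of `A`, so the product is `v (v' c')
c`, with the lower factors on the left and the upper ones on the right. -/
lemma GaugeRel.trans {q q' : 𝕜[X]} {A A' A'' : Matrix (Fin M) (Fin M) 𝕜} (h : GaugeRel q A A')
    (h' : GaugeRel q' A' A'') : GaugeRel (q + q') A A'' := by
  obtain ⟨v, c, hv, hc, he, rfl⟩ := h
  obtain ⟨v', c', hv', hc', he', rfl⟩ := h'
  have hdet := (Matrix.isUnit_iff_isUnit_det v).1 hv.isUnit
  refine ⟨v * v', c' * c, hv.mul hv', hc'.mul hc, ?_, ?_⟩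
  · rw [aeval_conj hv.isUnit, Matrix.exp_conj' _ _ hv.isUnit] at he'
    have hcomm : Commute (aeval A q') (aeval A q) := by
      rw [commute_iff_eq, ← map_mul, ← map_mul, mul_comm]
    rw [add_comm q, map_add, Matrix.exp_add_of_commute _ _ hcomm, he]
    calc NormedSpace.exp (aeval A q') * (v * c)
        = (v * v⁻¹) * NormedSpace.exp (aeval A q') * v * c := by
          rw [Matrix.mul_nonsing_inv v hdet]; noncomm_ring
      _ = v * (v⁻¹ * NormedSpace.exp (aeval A q') * v) * c := by noncomm_ring
      _ = _ := by rw [he']; noncomm_ring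
  · rw [Matrix.mul_inv_rev]
    noncomm_ring

lemma GaugeRel.refl (A : Matrix (Fin M) (Fin M) 𝕜) : GaugeRel 0 A A := by
  refine ⟨1, 1, ⟨fun i => by simp, fun i j hij => by simp [hij.ne]⟩,
    ⟨isUnit_one, fun i j hij => by simp [hij.ne']⟩, ?_, by simp⟩
  rw [map_zero, NormedSpace.exp_zero, one_mul]

end GaugeRelation

/-! ### Factorization along a flow for short time -/

section Local

open Polynomial Filter Topology

variable {𝕜 : Type*} [RCLike 𝕜] {M : ℕ}

/-- The projection onto weakly upper triangular matrices as a linear map. -/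
def upperPartLinear (𝕜 : Type*) [RCLike 𝕜] (M : ℕ) :
    Matrix (Fin M) (Fin M) 𝕜 →ₗ[𝕜] Matrix (Fin M) (Fin M) 𝕜 where
  toFun := upperPart
  map_add' A B := by
    ext i j
    by_cases h : i ≤ j <;> simp [upperPart, h]
  map_smul' c A := by
    ext i j
    by_cases h : i ≤ j <;> simp [upperPart, h]

lemma upperPart_mul_upperPart_left {A N : Matrix (Fin M) (Fin M) 𝕜}
    (hN : ∀ i j : Fin M, i ≤ j → N i j = 0) : upperPart (upperPart A * N) = upperPart (A * N) := by
  ext i j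
  simp only [upperPart, Matrix.of_apply]
  split_ifs with hij
  · simp only [Matrix.mul_apply, Matrix.of_apply]
    refine Finset.sum_congr rfl fun r _ => ?_
    by_cases hr : i ≤ r
    · rw [if_pos hr]
    · rw [hN r j (by omega), mul_zero, mul_zero]
  · rfl

/-- Upper triangular multiplication on the left preserves upper triangular matrices, so it acts on
the quotient by them. This closes the equation for the strictly lower part of `b`. -/
lemma sub_upperPart_mul {A B : Matrix (Fin M) (Fin M) 𝕜}
    (hB : ∀ i j : Fin M, j < i → B i j = 0) :
    B * (A - upperPart A) - upperPart (B * (A - upperPart A)) = B * A - upperPart (B * A) := by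
  ext i j
  simp only [upperPart, Matrix.of_apply, Matrix.sub_apply]
  split_ifs with hij
  · rw [sub_self, sub_self]
  · simp only [Matrix.mul_apply, Matrix.of_apply, Matrix.sub_apply, sub_zero]
    refine Finset.sum_congr rfl fun r _ => ?_
    by_cases hr : r < i
    · rw [hB i r hr, zero_mul, zero_mul]
    · rw [if_neg (by omega), sub_zero]

attribute [local instance] Matrix.linftyOpNormedRing Matrix.linftyOpNormedAlgebra in
/-- Along a solution curve of the flow `t_k` the Lax matrix moves, locally, by the factorization
of the exponential. -/
lemma eventually_gaugeRel (k : ℕ) (a : 𝕜) {ℓ : ℝ → Matrix (Fin M) (Fin M) 𝕜} {x₀ : ℝ}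
    (hℓ : ∀ᶠ x in 𝓝 x₀, HasDerivAt ℓ
      (a • (upperPart (ℓ x ^ k) * ℓ x - ℓ x * upperPart (ℓ x ^ k))) x) :
    ∀ᶠ x in 𝓝 x₀, GaugeRel (C (((x - x₀ : ℝ) : 𝕜) * a) * X ^ k) (ℓ x₀) (ℓ x) := by
  let Q : Matrix (Fin M) (Fin M) 𝕜 →L[ℝ] Matrix (Fin M) (Fin M) 𝕜 :=
    (LinearMap.toContinuousLinearMap (upperPartLinear 𝕜 M)).restrictScalars ℝ
  have hQ : ∀ A, Q A = upperPart A := fun _ => rfl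
  let β : ℝ → Matrix (Fin M) (Fin M) 𝕜 := fun x => a • upperPart (ℓ x ^ k)
  let μ : ℝ → Matrix (Fin M) (Fin M) 𝕜 := fun x => a • ℓ x ^ k
  have hcμ : ∀ᶠ x in 𝓝 x₀, ContinuousAt μ x := by
    filter_upwards [hℓ] with x hx
    exact (hx.continuousAt.pow k).const_smul a
  have hcβ : ∀ᶠ x in 𝓝 x₀, ContinuousAt β x := by
    filter_upwards [hℓ] with x hx
    exact (Q.continuous.continuousAt.comp (hx.continuousAt.pow k)).const_smul a
  have hμ : ∀ x d, ℓ x₀ * d = d * ℓ x → μ x₀ * d = d * μ x := by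
    intro x d h
    have hpow : ∀ n : ℕ, ℓ x₀ ^ n * d = d * ℓ x ^ n := fun n => by
      induction n with
      | zero => simp
      | succ n ih => rw [pow_succ, mul_assoc, h, ← mul_assoc, ih, mul_assoc, ← pow_succ]
    simp only [μ, Matrix.smul_mul, Matrix.mul_smul, hpow]
  obtain ⟨b, d, hb0, hd0, hbd⟩ := exists_gauge_of_lax (x₀ := x₀) (ℓ := ℓ) (β := β) (μ := μ) hcβ
    (hℓ.mono fun x hx => hx.congr_deriv (by
      simp only [β, Matrix.smul_mul, Matrix.mul_smul, smul_sub])) hμ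
  have hβup : ∀ x, ∀ i j : Fin M, j < i → β x i j = 0 := by
    intro x i j hij
    simp [β, upperPart, not_le.2 hij]
  have hνlow : ∀ x, ∀ i j : Fin M, i ≤ j → (μ x - β x) i j = 0 := by
    intro x i j hij
    simp [β, μ, upperPart, hij]
  let mulL := ContinuousLinearMap.mul ℝ (Matrix (Fin M) (Fin M) 𝕜)
  have hblow : ∀ᶠ x in 𝓝 x₀, b x - upperPart (b x) = 0 := by
    let Λ := ContinuousLinearMap.id ℝ (Matrix (Fin M) (Fin M) 𝕜) - Q
    refine eventually_eq_zero_of_hasDerivAt_linear (T := fun x => Λ.comp (mulL (β x)))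
      ?_ ?_ ?_
    · exact continuousAt_const.clm_comp (mulL.continuous.continuousAt.comp hcβ.self_of_nhds)
    · filter_upwards [hbd] with x hx
      refine (Λ.hasFDerivAt.comp_hasDerivAt x hx.1).congr_deriv ?_
      exact (sub_upperPart_mul (hβup x)).symm
    · rw [hb0]
      ext i j
      by_cases h : i ≤ j
      · simp [upperPart, h]
      · simp [upperPart, h, Matrix.one_apply, (not_le.1 h).ne']
  -- With `ν = μ - β` strictly lower, `u' = uν = (u - 1)ν + ν`. The upper part kills the last term
  -- and leaves a homogeneous linear equation for the upper part of `u - 1`.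
  have hulow : ∀ᶠ x in 𝓝 x₀,
      upperPart (NormedSpace.exp ((x - x₀) • μ x₀) * d x - 1) = 0 := by
    refine eventually_eq_zero_of_hasDerivAt_linear
      (T := fun x => Q.comp (mulL.flip (μ x - β x))) ?_ ?_ ?_
    · exact continuousAt_const.clm_comp (mulL.flip.continuous.continuousAt.comp
        (hcμ.self_of_nhds.sub hcβ.self_of_nhds))
    · filter_upwards [hbd] with x hx
      refine (Q.hasFDerivAt.comp_hasDerivAt x (hx.2.2.2.2.sub_const 1)).congr_deriv ?_
      change upperPart (_ : Matrix (Fin M) (Fin M) 𝕜) =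
        upperPart (upperPart (_ : Matrix (Fin M) (Fin M) 𝕜) * (_ : Matrix (Fin M) (Fin M) 𝕜))
      have h1 : upperPart (μ x - β x) = 0 := by
        ext i j
        by_cases h : i ≤ j
        · simpa [upperPart, h] using hνlow x i j h
        · simp [upperPart, h]
      rw [upperPart_mul_upperPart_left (hνlow x), sub_mul, one_mul, ← hQ, ← hQ, map_sub, hQ (μ x - β x),
        h1, sub_zero]
      rfl
    · rw [sub_self, zero_smul, NormedSpace.exp_zero, one_mul, hd0, sub_self, ← hQ, map_zero]
  filter_upwards [hbd, hblow, hulow] with x ⟨_, hdb, hbd', hconj, _⟩ hbl hul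
  set e := NormedSpace.exp ((x - x₀) • μ x₀) with he
  have hu : IsLowerUnipotent (e * d x) := by
    have h : ∀ i j : Fin M, i ≤ j → (e * d x) i j = (1 : Matrix (Fin M) (Fin M) 𝕜) i j := by
      intro i j hij
      have := congrFun (congrFun hul i) j
      simpa [upperPart, hij, sub_eq_zero] using this
    exact ⟨fun i => by simp [h i i le_rfl], fun i j hij => by simp [h i j hij.le, hij.ne]⟩
  have hdetu := (Matrix.isUnit_iff_isUnit_det _).1 hu.isUnit
  refine ⟨e * d x, b x, hu, ⟨IsUnit.of_mul_eq_one _ hbd', fun i j hij => ?_⟩, ?_, ?_⟩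
  · have := congrFun (congrFun hbl i) j
    simpa [upperPart, not_le.2 hij] using this
  · rw [mul_assoc, hdb, mul_one, he]
    congr 1
    rw [map_mul, aeval_C, map_pow, aeval_X, ← Algebra.smul_def, mul_smul]
    ext i j
    simp [μ, RCLike.real_smul_eq_coe_mul]
  · have hcomm : Commute (ℓ x₀) e := by
      refine Commute.exp_right ?_
      exact (((Commute.refl _).pow_right k).smul_right a).smul_right (x - x₀)
    have h1 : ℓ x₀ * (e * d x) = e * d x * ℓ x := by
      rw [← mul_assoc, hcomm.eq, mul_assoc, hconj, mul_assoc]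
    rw [mul_assoc, h1, ← mul_assoc, Matrix.nonsing_inv_mul _ hdetu, one_mul]

end Local

/-! ### Propagation along segments, boxes and paths -/

section Global

open Polynomial Filter Topology

variable {𝕜 : Type*} [RCLike 𝕜] {M : ℕ}

attribute [local instance] Matrix.linftyOpNormedRing Matrix.linftyOpNormedAlgebra in
lemma hasDerivAt_matrix {ℓ : ℝ → Matrix (Fin M) (Fin M) 𝕜} {ℓ' : Matrix (Fin M) (Fin M) 𝕜}
    {x : ℝ} (h : ∀ i j, HasDerivAt (fun y => ℓ y i j) (ℓ' i j) x) : HasDerivAt ℓ ℓ' x := by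
  have h1 : ∀ A : Matrix (Fin M) (Fin M) 𝕜,
      A = ∑ i, ∑ j, A i j • Matrix.single i j (1 : 𝕜) := by
    intro A
    conv_lhs => rw [Matrix.matrix_eq_sum_single A]
    simp
  have h2 : ℓ = fun y => ∑ i, ∑ j, ℓ y i j • Matrix.single i j (1 : 𝕜) := funext fun y => h1 _
  rw [h2, h1 ℓ']
  exact HasDerivAt.fun_sum fun i _ => HasDerivAt.fun_sum fun j _ => (h i j).smul_const _

/-- Restricting to the real parameter `x ↦ t + x a` in direction `k` treats real and complex times
alike; the local relations are then chained over `[0, 1]`. -/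
lemma IsSolution.gaugeRel_segment {K : Set ℕ+} {U : Set (Times 𝕜)}
    {L : Times 𝕜 → Matrix (Fin M) (Fin M) 𝕜} (hL : IsSolution K U L) {k : ℕ+} (hk : k ∈ K)
    {t : Times 𝕜} {a : 𝕜} {ε : ℝ} (ha : ‖a‖ < ε)
    (hU : ∀ c : 𝕜, ‖c‖ < ε → t + c • timeDir 𝕜 k ∈ U) :
    GaugeRel (C a * X ^ (k : ℕ)) (L t) (L (t + a • timeDir 𝕜 k)) := by
  let ℓ : ℝ → Matrix (Fin M) (Fin M) 𝕜 := fun x => L (t + ((x : 𝕜) * a) • timeDir 𝕜 k)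
  have hder : ∀ x : ℝ, ‖(x : 𝕜) * a‖ < ε → ∀ i j, HasDerivAt (fun y => ℓ y i j)
      ((a • (upperPart (ℓ x ^ (k : ℕ)) * ℓ x - ℓ x * upperPart (ℓ x ^ (k : ℕ)))) i j) x := by
    intro x hx i j
    have h1 := hL.flow k hk _ (hU _ hx) i j
    have h2 : HasDerivAt (fun y : ℝ => ((y - x : ℝ) : 𝕜) * a) a x := by
      have h3 : HasDerivAt (fun y : ℝ => ((y - x : ℝ) : 𝕜)) 1 x := by
        have := (RCLike.ofRealCLM (K := 𝕜)).hasFDerivAt.comp_hasDerivAt x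
          ((hasDerivAt_id x).sub_const x)
        simpa [Function.comp_def] using this
      simpa using h3.mul_const a
    have h4 := HasDerivAt.scomp_of_eq x (h := fun y : ℝ => ((y - x : ℝ) : 𝕜) * a) h1 h2 (by simp)
    refine (h4.congr_deriv ?_).congr_of_eventuallyEq (Eventually.of_forall fun y => ?_)
    · simp [ℓ]
    · simp only [ℓ, Function.comp_apply]
      rw [add_assoc, ← add_smul, ← add_mul, ← RCLike.ofReal_add, add_sub_cancel]
  have hnorm : ∀ x ∈ Set.Icc (0 : ℝ) 1, ‖(x : 𝕜) * a‖ < ε := by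
    intro x hx
    rw [norm_mul, RCLike.norm_ofReal, abs_of_nonneg hx.1]
    nlinarith [norm_nonneg a, hx.2]
  have hloc : ∀ x ∈ Set.Icc (0 : ℝ) 1, ∀ᶠ y in 𝓝 x,
      GaugeRel (C (((y - x : ℝ) : 𝕜) * a) * X ^ (k : ℕ)) (ℓ x) (ℓ y) := by
    intro x hx
    refine eventually_gaugeRel (k : ℕ) a ?_
    have hcont : Continuous fun y : ℝ => ‖(y : 𝕜) * a‖ := by fun_prop
    filter_upwards [(hcont.tendsto x).eventually (gt_mem_nhds (hnorm x hx))] with y hy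
    exact hasDerivAt_matrix (hder y hy)
  have h := isPreconnected_Icc.induction₂' (s := Set.Icc (0 : ℝ) 1)
    (fun x y => GaugeRel (C (((y - x : ℝ) : 𝕜) * a) * X ^ (k : ℕ)) (ℓ x) (ℓ y))
    (fun x hx => by
      filter_upwards [mem_nhdsWithin_of_mem_nhds (hloc x hx)] with y hy
      refine ⟨hy, ?_⟩
      convert hy.symm using 1
      rw [← neg_mul, ← C_neg, ← neg_mul]
      push_cast
      ring_nf)
    (fun x y z _ _ _ hxy hyz => by
      convert hxy.trans hyz using 1
      rw [← add_mul, ← C_add, ← add_mul]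
      push_cast
      ring_nf)
    (x := 0) (y := 1) (by simp) (by simp)
  simpa [ℓ] using h

/-- Differentiability is known only in each time separately, so the times are changed one after
another; every intermediate point stays in the box. -/
lemma IsSolution.gaugeRel_box {K : Set ℕ+} {U : Set (Times 𝕜)}
    {L : Times 𝕜 → Matrix (Fin M) (Fin M) 𝕜} (hL : IsSolution K U L) {S : Finset ℕ+}
    (hS : (S : Set ℕ+) ⊆ K) {t t' : Times 𝕜} {ε : ℝ} (hε : 0 < ε)
    (hU : ∀ t' : Times 𝕜, (∀ n ∈ S, ‖t' n - t n‖ < ε) → (∀ n, n ∉ S → t' n = t n) → t' ∈ U)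
    (ht' : ∀ n ∈ S, ‖t' n - t n‖ < ε) (ht'' : ∀ n, n ∉ S → t' n = t n) :
    GaugeRel (∑ n ∈ S, C (t' n - t n) * X ^ (n : ℕ)) (L t) (L t') := by
  have key : ∀ S' : Finset ℕ+, S' ⊆ S → GaugeRel (∑ n ∈ S', C (t' n - t n) * X ^ (n : ℕ)) (L t)
      (L fun n => if n ∈ S' then t' n else t n) := by
    intro S'
    induction S' using Finset.induction_on with
    | empty => exact fun _ => by simpa using GaugeRel.refl (L t)
    | insert k S' hk ih =>
      intro hsub
      have hkS : k ∈ S := hsub (Finset.mem_insert_self _ _)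
      have h1 := ih fun n hn => hsub (Finset.mem_insert_of_mem hn)
      have h2 := hL.gaugeRel_segment (hS hkS) (t := fun n => if n ∈ S' then t' n else t n)
        (ht' k hkS) (fun c hc => hU _ (fun n hn => ?_) fun n hn => ?_)
      · rw [Finset.sum_insert hk, add_comm]
        convert h1.trans h2 using 2
        ext n
        by_cases hn : n = k
        · subst hn
          simp [timeDir, hk]
        · simp [timeDir, hn]
      · by_cases hnk : n = k
        · subst hnk
          simpa [timeDir, hk] using hc
        · by_cases hnS : n ∈ S'
          · simpa [timeDir, hnk, hnS] using ht' n hn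
          · simpa [timeDir, hnk, hnS] using hε
      · have hnk : n ≠ k := fun h => hn (h ▸ hkS)
        have hnS : n ∉ S' := fun h => hn (hsub (Finset.mem_insert_of_mem h))
        simp [timeDir, hnk, hnS]
  convert key S subset_rfl using 2
  ext n
  split_ifs with hn
  · rfl
  · exact ht'' n hn

/-- No regularity of `L` along the path is needed: nearby path points lie in a common box, and the
exponents `∑ (γ y n - γ x n) Xⁿ` add up along a chain. -/
lemma IsSolution.gaugeRel_of_joinedIn {K : Set ℕ+} {U : Set (Times 𝕜)}
    {L : Times 𝕜 → Matrix (Fin M) (Fin M) 𝕜} (hU : IsTimeDomain K U) (hL : IsSolution K U L)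
    {t : Times 𝕜} {S : Finset ℕ+} (hS : (S : Set ℕ+) ⊆ K)
    (h : JoinedIn {t' : Times 𝕜 | t' ∈ U ∧ ∀ n, n ∉ S → t' n = 0} 0 t) :
    GaugeRel (∑ n ∈ S, C (t n) * X ^ (n : ℕ)) (L 0) (L t) := by
  let γ := h.somePath
  have hγ : ∀ x, γ x ∈ U ∧ ∀ n, n ∉ S → γ x n = 0 := fun x => h.somePath_mem x
  let P : unitInterval → unitInterval → Prop := fun x y =>
    GaugeRel (∑ n ∈ S, C (γ y n - γ x n) * X ^ (n : ℕ)) (L (γ x)) (L (γ y))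
  have hsymm : ∀ x y, P x y → P y x := by
    intro x y hxy
    convert GaugeRel.symm hxy using 1
    rw [← Finset.sum_neg_distrib]
    refine Finset.sum_congr rfl fun n _ => ?_
    rw [← neg_mul, ← C_neg, neg_sub]
  have htrans : IsTrans unitInterval P := by
    refine ⟨fun x y z hxy hyz => ?_⟩
    change GaugeRel _ _ _
    convert GaugeRel.trans hxy hyz using 1
    rw [← Finset.sum_add_distrib]
    refine Finset.sum_congr rfl fun n _ => ?_
    rw [← add_mul, ← C_add]
    ring_nf
  have hloc : ∀ x, ∀ᶠ y in 𝓝 x, P x y := by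
    intro x
    obtain ⟨ε, hε, hbox⟩ := hU.finitely_open (γ x) (hγ x).1 S hS
    have hev : ∀ᶠ y in 𝓝 x, ∀ n ∈ S, ‖γ y n - γ x n‖ < ε := by
      rw [Filter.eventually_all_finset]
      intro n _
      have hcont : Continuous fun y => ‖γ y n - γ x n‖ :=
        (((continuous_apply n).comp γ.continuous).sub continuous_const).norm
      refine (hcont.tendsto x).eventually (gt_mem_nhds ?_)
      simpa using hε
    filter_upwards [hev] with y hy
    exact hL.gaugeRel_box hS hε hbox hy fun n hn => by rw [(hγ x).2 n hn, (hγ y).2 n hn]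
  have hP : P 0 1 :=
    PreconnectedSpace.induction₂' P (fun x => (hloc x).mono fun y hy => ⟨hy, hsymm _ _ hy⟩)
      htrans 0 1
  simpa [P] using hP

lemma hasSum_of_support {A : Matrix (Fin M) (Fin M) 𝕜} {t : Times 𝕜} {S : Finset ℕ+}
    (h : ∀ n, n ∉ S → t n = 0) :
    HasSum (fun n : ℕ+ => t n • A ^ (n : ℕ)) (aeval A (∑ n ∈ S, C (t n) * X ^ (n : ℕ))) := by
  have hq : aeval A (∑ n ∈ S, C (t n) * X ^ (n : ℕ)) = ∑ n ∈ S, t n • A ^ (n : ℕ) := by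
    simp [Algebra.smul_def]
  rw [hq]
  exact hasSum_sum_of_ne_finset_zero fun n hn => by rw [h n hn, zero_smul]

end Global

end FullKostantToda

theorem mainTheorem1 {𝕜 : Type*} [RCLike 𝕜] (M : ℕ) :
    (∀ (K : Set ℕ+) (U : Set (FullKostantToda.Times 𝕜))
        (L : FullKostantToda.Times 𝕜 → Matrix (Fin M) (Fin M) 𝕜),
      FullKostantToda.IsTimeDomain K U → FullKostantToda.IsSolution K U L →
        ∀ t ∈ U, FullKostantToda.HasTauEntries (L 0) t (L t)) ∧
    (∀ L₀ : Matrix (Fin M) (Fin M) 𝕜, FullKostantToda.IsHessenberg L₀ →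
      ∀ t : FullKostantToda.Times 𝕜, Summable (fun n : ℕ+ => t n • L₀ ^ (n : ℕ)) →
        ∀ u b : Matrix (Fin M) (Fin M) 𝕜,
          FullKostantToda.IsLowerUnipotent u → FullKostantToda.IsUpperInvertible b →
          NormedSpace.exp (FullKostantToda.theta L₀ t) = u * b →
            FullKostantToda.HasTauEntries L₀ t (u⁻¹ * L₀ * u)) := by
  refine ⟨fun K U L hU hL t ht => ?_, fun L₀ hL₀ t ht u b hu hb h =>
    FullKostantToda.hasTauEntries_of_factorization hL₀ ht hu hb h⟩
  obtain ⟨S, hS, hjoin⟩ := hU.joined t ht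
  -- For finitely many active times, `Θ` is the polynomial exponent of the gauge relation evaluated
  -- at `L 0`.
  have hsum := FullKostantToda.hasSum_of_support (A := L 0) hjoin.target_mem.2
  obtain ⟨u, b, hu, hb, h, hLt⟩ := hL.gaugeRel_of_joinedIn hU hS hjoin
  rw [hLt]
  refine FullKostantToda.hasTauEntries_of_factorization (hL.hessenberg 0 hjoin.source_mem.1)
    hsum.summable hu hb ?_
  rw [← h, ← hsum.tsum_eq]
  rfl
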